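/- Let $k$ be a field of arbitrary characteristic, let $n=2m+1$ be a positive odd integer, and let $R=k[x_1,\dots,x_n]$ be graded by $\deg x_l=d_l$, where the $d_l$ are positive integers; put $d=\sum_{l=1}^n d_l$. For a graded $R$-module $N$ write $N(a)_j=N_{a+j}$. Write $F^\vee=\operatorname{Hom}_R(F,R(-d))$, and for a graded $R$-module $M$ of finite length let $M^*=\operatorname{Hom}_k(M,k)$ with $(rf)(x)=f(rx)$ and $(M^*)_j=\operatorname{Hom}_k(M_{-j},k)$. Call $M$ Gorenstein if, for some $s\in\mathbb Z$ and some choice of sign, there is a graded $R$-module isomorphism $\tau\colon M\to M^*(-s)$ with $\tau^*(-s)=\pm\tau$; here $\tau^*=\operatorname{Hom}_k(\tau,k)$ and $M$ is identified with $M^{**}$ canonically, so that the condition says $\tau(y)(x)=\pm\tau(x)(y)$ for all $x,y\in M$. **Theorem.** Let $M$ be a graded $R$-module of finite length, let $s\in\mathbb Z$, let $\varepsilon\in\{1,-1\}$, and suppose that $M$ has a minimal graded free resolution (by graded free modules of finite rank, with homogeneous maps of degree $0$) of the form $$0\leftarrow M\leftarrow F_0\xleftarrow{\psi_1}F_1\leftarrow\cdots\leftarrow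 F_m\xleftarrow{\psi_{m+1}}F_m^\vee(-s)\xleftarrow{\psi_m^\vee(-s)}\cdots\leftarrow F_1^\vee(-s)\xleftarrow{\psi_1^\vee(-s)}F_0^\vee(-s)\leftarrow 0$$ such that $\psi_{m+1}^\vee=\varepsilon\,\psi_{m+1}$ up to twist and the canonical identification $F_m\cong F_m^{\vee\vee}$. Then there is a graded $R$-module isomorphism $$\tau\colon M\to M^*(-s)=\operatorname{Hom}_k(M,k)(-s)\qquad\text{with}\qquad \tau^*(-s)=\varepsilon\,(-1)^m\,\tau .$$ In particular, $M$ is Gorenstein. -/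

import Mathlib

open MvPolynomial

noncomputable section

namespace SelfdualRes

universe u v v'

section Gradings

variable {k : Type u} [Field k] {M : Type v} [AddCommGroup M] [Module k M]

/-- The twist `M(a)` of a graded vector space: `M(a)_j = M_{j+a}`. -/
def twist (𝓜 : ℤ → Submodule k M) (a : ℤ) : ℤ → Submodule k M := fun j => 𝓜 (j + a)

/-- The weighted grading of `R = k[x_1, …, x_n]` with `deg x_l = w l`. -/
abbrev polyGrading (k : Type u) [Field k] {n : ℕ} (w : Fin n → ℤ) :
    ℤ → Submodule k (MvPolynomial (Fin n) k) :=
  weightedHomogeneousSubmodule k w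

/-- The irrelevant ideal `(x_1, …, x_n)` of `R`. -/
def irrelevant (k : Type u) [Field k] (n : ℕ) : Ideal (MvPolynomial (Fin n) k) :=
  Ideal.span (Set.range X)

/-- `M = ⨁_j M_j` is a `ℤ`-graded module over the weighted polynomial ring `R`. -/
structure IsGradedModule {n : ℕ} (w : Fin n → ℤ) [Module (MvPolynomial (Fin n) k) M]
    (𝓜 : ℤ → Submodule k M) : Prop where
  isInternal : DirectSum.IsInternal 𝓜
  gradedSMul : SetLike.GradedSMul (polyGrading k w) 𝓜

/-- A graded free `R`-module of finite rank: a graded module with a finite homogeneous basis,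
that is, a module of the form `⨁_j R(-a_j)`. -/
structure IsGradedFree {n : ℕ} (w : Fin n → ℤ) [Module (MvPolynomial (Fin n) k) M]
    (𝓜 : ℤ → Submodule k M) : Prop where
  isGradedModule : IsGradedModule w 𝓜
  exists_basis : ∃ (r : ℕ) (b : Module.Basis (Fin r) (MvPolynomial (Fin n) k) M) (a : Fin r → ℤ),
    ∀ j, b j ∈ 𝓜 (a j)

variable {N : Type v'} [AddCommGroup N] [Module k N]

/-- `f` is homogeneous of degree `0`. -/
def IsGradedHom {n : ℕ} [Module (MvPolynomial (Fin n) k) M] [Module (MvPolynomial (Fin n) k) N]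
    (𝓜 : ℤ → Submodule k M) (𝓝 : ℤ → Submodule k N) (f : M →ₗ[MvPolynomial (Fin n) k] N) :
    Prop :=
  ∀ (j : ℤ) (x : M), x ∈ 𝓜 j → f x ∈ 𝓝 j

/-- `e` is an isomorphism of graded modules: `e` and its inverse are homogeneous of degree `0`. -/
def IsGradedIso {n : ℕ} [Module (MvPolynomial (Fin n) k) M] [Module (MvPolynomial (Fin n) k) N]
    (𝓜 : ℤ → Submodule k M) (𝓝 : ℤ → Submodule k N) (e : M ≃ₗ[MvPolynomial (Fin n) k] N) :
    Prop :=
  IsGradedHom 𝓜 𝓝 e.toLinearMap ∧ IsGradedHom 𝓝 𝓜 e.symm.toLinearMap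

end Gradings

section VectorSpaceDual

variable (k : Type u) [Field k]

/-- The vector space dual `M^* = Hom_k(M, k)`, to be regarded as an `R`-module. -/
def VDual (M : Type v) [AddCommGroup M] [Module k M] : Type (max u v) := Module.Dual k M

variable {k} {n : ℕ} {M : Type v} [AddCommGroup M] [Module k M]

instance : AddCommGroup (VDual k M) := inferInstanceAs (AddCommGroup (Module.Dual k M))

instance : Module k (VDual k M) := inferInstanceAs (Module k (Module.Dual k M))

instance : FunLike (VDual k M) M k := inferInstanceAs (FunLike (Module.Dual k M) M k)

variable [Module (MvPolynomial (Fin n) k) M] [IsScalarTower k (MvPolynomial (Fin n) k) M]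

/-- `R` acts on `M^*` by `(r f)(x) = f(r x)`. -/
instance : Module (MvPolynomial (Fin n) k) (VDual k M) where
  smul r f := LinearMap.comp (show Module.Dual k M from f) (Algebra.lsmul k k M r)
  one_smul f := LinearMap.ext fun x => congrArg f (one_smul _ x)
  mul_smul r t f := LinearMap.ext fun x =>
    congrArg f (show (r * t) • x = t • r • x by rw [mul_comm, mul_smul])
  smul_zero _ := rfl
  smul_add _ _ _ := rfl
  add_smul r t f := LinearMap.ext fun x =>
    (congrArg f (add_smul r t x)).trans (map_add (show Module.Dual k M from f) _ _)
  zero_smul f := LinearMap.ext fun x =>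
    (congrArg f (zero_smul (MvPolynomial (Fin n) k) x)).trans
      (map_zero (show Module.Dual k M from f))

instance : IsScalarTower k (MvPolynomial (Fin n) k) (VDual k M) where
  smul_assoc c r f := LinearMap.ext fun x =>
    (congrArg f (smul_assoc c r x)).trans (map_smul (show Module.Dual k M from f) _ _)

/-- The grading of `M^*`: `(M^*)_j` consists of the functionals that vanish on `M_i`
for all `i ≠ -j`, i.e. `(M^*)_j = Hom_k(M_{-j}, k)`. -/
def vdualGrading (𝓜 : ℤ → Submodule k M) : ℤ → Submodule k (VDual k M) := fun j =>
  { carrier := {f | ∀ (i : ℤ) (x : M), x ∈ 𝓜 i → i ≠ -j → f x = 0}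
    zero_mem' := fun _ _ _ _ => rfl
    add_mem' := fun {f g} hf hg i x hx hij =>
      show f x + g x = 0 by rw [hf i x hx hij, hg i x hx hij, add_zero]
    smul_mem' := fun c f hf i x hx hij =>
      show c * f x = 0 by rw [hf i x hx hij, mul_zero] }

variable {N : Type v'} [AddCommGroup N] [Module k N] [Module (MvPolynomial (Fin n) k) N]
  [IsScalarTower k (MvPolynomial (Fin n) k) N]

/-- `f^* = Hom_k(f, k) : N^* → M^*`. -/
def vdualMap (f : M →ₗ[MvPolynomial (Fin n) k] N) :
    VDual k N →ₗ[MvPolynomial (Fin n) k] VDual k M where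
  toFun g := LinearMap.comp (show Module.Dual k N from g) (f.restrictScalars k)
  map_add' _ _ := rfl
  map_smul' r g := LinearMap.ext fun x => congrArg g (map_smul f r x).symm

/-- The canonical map `M → M^{**}`, `x ↦ (g ↦ g x)`. -/
def vdualEval (n : ℕ) (M : Type v) [AddCommGroup M] [Module k M]
    [Module (MvPolynomial (Fin n) k) M] [IsScalarTower k (MvPolynomial (Fin n) k) M] :
    M →ₗ[MvPolynomial (Fin n) k] VDual k (VDual k M) where
  toFun := Module.Dual.eval k M
  map_add' := map_add (Module.Dual.eval k M)
  map_smul' _ _ := rfl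

/-- `τ^*(-s) = ε τ` for `τ : M → M^*(-s)`: the composite `M → M^{**} → M^*` of the canonical map
with `τ^*` equals `ε τ`. -/
def IsSelfTranspose (ε : ℤˣ) (τ : M →ₗ[MvPolynomial (Fin n) k] VDual k M) : Prop :=
  vdualMap τ ∘ₗ vdualEval n M = ε • τ

/-- `M` is Gorenstein: for some `s` there is a graded isomorphism `τ : M → M^*(-s)` with
`τ^*(-s) = ± τ`. -/
def IsGorenstein (n : ℕ) {M : Type v} [AddCommGroup M] [Module k M]
    [Module (MvPolynomial (Fin n) k) M] [IsScalarTower k (MvPolynomial (Fin n) k) M]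
    (𝓜 : ℤ → Submodule k M) : Prop :=
  ∃ (s : ℤ) (ε : ℤˣ) (τ : M ≃ₗ[MvPolynomial (Fin n) k] VDual k M),
    IsGradedIso 𝓜 (twist (vdualGrading 𝓜) (-s)) τ ∧ IsSelfTranspose ε τ.toLinearMap

end VectorSpaceDual

section Resolutions

variable {k : Type u} [Field k] {n : ℕ}

/-- The grading of `F^∨ = Hom_R(F, R(-d))`, where `d = deg x_1 + ⋯ + deg x_n`: the elements of
degree `j` are the `R`-linear maps that send `F_i` to `R(-d)_{i+j}` for every `i`. -/
def rdualGrading (w : Fin n → ℤ) {F : Type v} [AddCommGroup F] [Module k F]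
    [Module (MvPolynomial (Fin n) k) F] (𝓕 : ℤ → Submodule k F) :
    ℤ → Submodule k (Module.Dual (MvPolynomial (Fin n) k) F) := fun j =>
  { carrier := {φ | ∀ (i : ℤ) (x : F), x ∈ 𝓕 i →
      φ x ∈ twist (polyGrading k w) (-∑ l, w l) (i + j)}
    zero_mem' := fun _ _ _ => Submodule.zero_mem _
    add_mem' := fun hf hg i x hx => Submodule.add_mem _ (hf i x hx) (hg i x hx)
    smul_mem' := fun c _ hf i x hx => Submodule.smul_mem _ c (hf i x hx) }

section

variable {m : ℕ} {M : Type v} [AddCommGroup M] [Module (MvPolynomial (Fin n) k) M]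
  {F : Fin (m + 1) → Type v'} [∀ i, AddCommGroup (F i)]
  [∀ i, Module (MvPolynomial (Fin n) k) (F i)]

/-- The kernel of the map leaving `F_i` in the sequence
`0 ← M ← F_0 ← ⋯ ← F_m ← F_m^∨(-s) ← ⋯ ← F_0^∨(-s) ← 0`. -/
def kerAt (π : F 0 →ₗ[MvPolynomial (Fin n) k] M)
    (ψ : ∀ i : Fin m, F i.succ →ₗ[MvPolynomial (Fin n) k] F i.castSucc) :
    ∀ i : Fin (m + 1), Submodule (MvPolynomial (Fin n) k) (F i) :=
  Fin.cases (LinearMap.ker π) fun i => LinearMap.ker (ψ i)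

/-- The image of the map arriving at `F_i` in this sequence. -/
def imAt (ψ : ∀ i : Fin m, F i.succ →ₗ[MvPolynomial (Fin n) k] F i.castSucc)
    (μ : Module.Dual (MvPolynomial (Fin n) k) (F (Fin.last m)) →ₗ[MvPolynomial (Fin n) k]
      F (Fin.last m)) :
    ∀ i : Fin (m + 1), Submodule (MvPolynomial (Fin n) k) (F i) :=
  Fin.lastCases (LinearMap.range μ) fun i => LinearMap.range (ψ i)

/-- The kernel of the map leaving `F_i^∨(-s)` in this sequence. -/
def kerAtDual (ψ : ∀ i : Fin m, F i.succ →ₗ[MvPolynomial (Fin n) k] F i.castSucc)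
    (μ : Module.Dual (MvPolynomial (Fin n) k) (F (Fin.last m)) →ₗ[MvPolynomial (Fin n) k]
      F (Fin.last m)) :
    ∀ i : Fin (m + 1),
      Submodule (MvPolynomial (Fin n) k) (Module.Dual (MvPolynomial (Fin n) k) (F i)) :=
  Fin.lastCases (LinearMap.ker μ) fun i => LinearMap.ker (ψ i).dualMap

/-- The image of the map arriving at `F_i^∨(-s)` in this sequence. -/
def imAtDual (ψ : ∀ i : Fin m, F i.succ →ₗ[MvPolynomial (Fin n) k] F i.castSucc) :
    ∀ i : Fin (m + 1),
      Submodule (MvPolynomial (Fin n) k) (Module.Dual (MvPolynomial (Fin n) k) (F i)) :=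
  Fin.cases ⊥ fun i => LinearMap.range (ψ i).dualMap

end

/-- The sequence
`0 ← M ← F_0 ← F_1 ← ⋯ ← F_m ← F_m^∨(-s) ← ⋯ ← F_1^∨(-s) ← F_0^∨(-s) ← 0`
with the maps `π`, `ψ_1, …, ψ_m` (here `ψ i : F_{i+1} → F_i`), the middle map `μ = ψ_{m+1}`, and
the duals `ψ_m^∨(-s), …, ψ_1^∨(-s)` is a minimal graded free resolution of `M`: the `F_i` are graded
free of finite rank, the maps are homogeneous of degree `0`, the sequence is exact, and the image
of every map between free modules lies in `(x_1, …, x_n)` times its target. -/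
structure IsSelfdualMinimalResolution (w : Fin n → ℤ) (s : ℤ) {m : ℕ}
    {M : Type v} [AddCommGroup M] [Module k M] [Module (MvPolynomial (Fin n) k) M]
    (𝓜 : ℤ → Submodule k M)
    {F : Fin (m + 1) → Type v'} [∀ i, AddCommGroup (F i)] [∀ i, Module k (F i)]
    [∀ i, Module (MvPolynomial (Fin n) k) (F i)]
    (𝓕 : ∀ i, ℤ → Submodule k (F i))
    (π : F 0 →ₗ[MvPolynomial (Fin n) k] M)
    (ψ : ∀ i : Fin m, F i.succ →ₗ[MvPolynomial (Fin n) k] F i.castSucc)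
    (μ : Module.Dual (MvPolynomial (Fin n) k) (F (Fin.last m)) →ₗ[MvPolynomial (Fin n) k]
      F (Fin.last m)) : Prop where
  gradedFree : ∀ i, IsGradedFree w (𝓕 i)
  graded_aug : IsGradedHom (𝓕 0) 𝓜 π
  graded_map : ∀ i : Fin m, IsGradedHom (𝓕 i.succ) (𝓕 i.castSucc) (ψ i)
  graded_mid : IsGradedHom (twist (rdualGrading w (𝓕 (Fin.last m))) (-s)) (𝓕 (Fin.last m)) μ
  surjective_aug : Function.Surjective π
  exact : ∀ i, imAt ψ μ i = kerAt π ψ i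
  exact_dual : ∀ i, imAtDual ψ i = kerAtDual ψ μ i
  minimal : ∀ i, imAt ψ μ i ≤ irrelevant k n • ⊤
  minimal_dual : ∀ i, imAtDual ψ i ≤ irrelevant k n • ⊤

/-- `μ^∨ = ε μ` for `μ : F^∨ → F`, up to twist and the canonical map `F → F^{∨∨}`. -/
def IsSelfDualMap (ε : ℤˣ) {F : Type v} [AddCommGroup F] [Module (MvPolynomial (Fin n) k) F]
    (μ : Module.Dual (MvPolynomial (Fin n) k) F →ₗ[MvPolynomial (Fin n) k] F) : Prop :=
  μ.dualMap = ε • (Module.Dual.eval (MvPolynomial (Fin n) k) F ∘ₗ μ)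

end Resolutions

end SelfdualRes

end

/-!
The isomorphism `τ` is given by an explicit residue pairing on `M`.

Regard the resolution as one free module `G = ⨁ F_i ⊕ ⨁ F_i^∨` with a differential `d`, bigraded by
homological and internal degree. As `M` is graded of finite length, there is an `N > 0` such that
every `y_l = X_l ^ N` kills `M`. So `y_l` acts as zero on the homology of `(G, d)`, and since `G` is
free there is a homogeneous null-homotopy `h_l`, that is, `d h_l + h_l d = y_l`
(`exists_homotopy`). For `f ∈ F_0` the element `h_0 ⋯ h_{n-1} f` lies in the last term `F_0^∨` of
the resolution, so it can be evaluated at `g ∈ F_0`. Let `β f g` be the coefficient of the socle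
monomial `∏ X_l ^ (N - 1)` of `R / (y_0, …, y_{n-1})` in the polynomial `(h_0 ⋯ h_{n-1} f)(g)`.

Three facts make `β` descend to a pairing on `M` that induces `τ` (`exists_pairing`).

* Evaluation is a symmetric bilinear form on `G` for which `d` is self-adjoint, except that the
  sign `ε` appears at the middle map `μ`. In `⟨h_0 ⋯ h_{n-1} f, g⟩` the homotopies can be moved to
  the second argument one at a time. Moving `h_j` compares two polynomials `T_{j+1}` and `T_j`:
  modulo the `y_l` with `l ≠ j`, one finds `y_j T_{j+1} = ± y_j T_j`, and `y_j` can be cancelled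
  because it is regular modulo the other `y_l` (`bilin_iterComp_sub_mem`). The sign is `(-1)^j`, as
  `d` passes `j` homotopies, times `ε` for `j = m`. The product of all the signs is `ε (-1)^m`.
* If `g` is a boundary, then `d` can be moved to the first argument, where it gives a multiple of
  the `y_l`, which has no socle coefficient. With the symmetry, this shows that `β` descends to `M`.
* If `β f = 0`, then `h_0 ⋯ h_{n-1} f` is divisible by `(y_0, …, y_{n-1})`, because
  `R / (y_0, …, y_{n-1})` is Gorenstein. Stripping off the homotopies one at a time, again by
  regularity, shows that `f` is a boundary (`mem_range_of_iterComp_mem`). So the pairing on `M` is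
  nondegenerate, and perfect since `M` is finite-dimensional.

The homotopies being homogeneous, the pairing of `M_i` with `M_j` vanishes unless `i + j = s`.
-/

noncomputable section
namespace SelfdualRes

/-! ### Iterated contracting homotopies -/

section Homotopy

variable {R : Type*} [CommRing R] {G : Type*} [AddCommGroup G] [Module R G]

/-- The composite `h_j ∘ h_{j+1} ∘ ⋯ ∘ h_{j+i-1}` of `i` consecutive members of a sequence of
endomorphisms. -/
def iterComp (h : ℕ → Module.End R G) : ℕ → ℕ → Module.End R G
  | _, 0 => 1
  | j, i + 1 => h j * iterComp h (j + 1) i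

/-- The submodule `(y_l : l ∈ S) G`. -/
def spanSMul (G : Type*) [AddCommGroup G] [Module R G] (y : ℕ → R) (S : Set ℕ) : Submodule R G :=
  Ideal.span (y '' S) • ⊤

variable {y : ℕ → R} {S T : Set ℕ} {x : G}

lemma spanSMul_mono (hST : S ⊆ T) : spanSMul G y S ≤ spanSMul G y T :=
  Submodule.smul_mono_left (Ideal.span_mono (Set.image_mono hST))

lemma map_mem_spanSMul {H : Type*} [AddCommGroup H] [Module R H] (f : G →ₗ[R] H)
    (hx : x ∈ spanSMul G y S) : f x ∈ spanSMul H y S := by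
  have h1 : f x ∈ (spanSMul G y S).map f := Submodule.mem_map_of_mem hx
  rw [spanSMul, Submodule.map_smul''] at h1
  exact Submodule.smul_mono le_rfl le_top h1

lemma smul_mem_spanSMul {j : ℕ} (hj : j ∈ S) (x : G) : y j • x ∈ spanSMul G y S :=
  Submodule.smul_mem_smul (Ideal.subset_span ⟨j, hj, rfl⟩) trivial

lemma spanSMul_empty : spanSMul G y ∅ = ⊥ := by
  simp [spanSMul]

lemma mem_spanSMul_self {r : R} : r ∈ spanSMul R y S ↔ r ∈ Ideal.span (y '' S) := by
  simp [spanSMul]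

lemma exists_of_mem_spanSMul_insert {j : ℕ} (hx : x ∈ spanSMul G y (insert j S)) :
    ∃ v, ∃ z ∈ spanSMul G y S, x = y j • v + z := by
  rw [spanSMul, Set.image_insert_eq, Ideal.span_insert, Submodule.sup_smul,
    Submodule.ideal_span_singleton_smul, Submodule.mem_sup] at hx
  obtain ⟨a, ha, z, hz, rfl⟩ := hx
  obtain ⟨v, -, rfl⟩ := Submodule.mem_smul_pointwise_iff_exists _ _ _ |>.1 ha
  exact ⟨v, z, hz, rfl⟩

variable {d : Module.End R G} {h : ℕ → Module.End R G}

lemma homotopy_apply (hd : ∀ l, d * h l + h l * d = y l • 1) (l : ℕ) (x : G) :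
    d (h l x) = y l • x - h l (d x) := by
  have := LinearMap.congr_fun (hd l) x
  simp only [LinearMap.add_apply, Module.End.mul_apply, LinearMap.smul_apply,
    Module.End.one_apply] at this
  rw [← this, add_sub_cancel_right]

lemma d_iterComp_mem (hd : ∀ l, d * h l + h l * d = y l • 1) {f : G} (hf : d f = 0) (i j : ℕ) :
    d (iterComp h j i f) ∈ spanSMul G y (Set.Ico j (j + i)) := by
  induction i generalizing j with
  | zero => simp [iterComp, hf]
  | succ i ih =>
    rw [iterComp, Module.End.mul_apply, homotopy_apply hd]
    refine Submodule.sub_mem _ (smul_mem_spanSMul (by simp) _) (map_mem_spanSMul _ ?_)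
    exact spanSMul_mono (Set.Ico_subset_Ico (by omega) (by omega)) (ih (j + 1))

/-- In `d h_i ⋯ h_{i+j}`, moving `d` to the right past all factors but the last costs the sign
`(-1)^j`, up to multiples of `y_i, …, y_{i+j-1}`. -/
lemma d_iterComp_succ_sub_mem (hd : ∀ l, d * h l + h l * d = y l • 1) {g : G} (hg : d g = 0)
    (j i : ℕ) :
    d (iterComp h i (j + 1) g) - (-1 : R) ^ j • y (i + j) • iterComp h i j g ∈
      spanSMul G y (Set.Ico i (i + j)) := by
  induction j generalizing i with
  | zero => simp [iterComp, homotopy_apply hd, hg]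
  | succ j ih =>
    have h1 := spanSMul_mono (Set.Ico_subset_Ico (by omega) (by omega) :
      Set.Ico (i + 1) (i + 1 + j) ⊆ Set.Ico i (i + (j + 1))) (ih (i + 1))
    have h2 : d (iterComp h i (j + 1 + 1) g)
          - (-1 : R) ^ (j + 1) • y (i + (j + 1)) • iterComp h i (j + 1) g
        = y i • iterComp h (i + 1) (j + 1) g - h i (d (iterComp h (i + 1) (j + 1) g)
          - (-1 : R) ^ j • y (i + 1 + j) • iterComp h (i + 1) j g) := by
      rw [iterComp, Module.End.mul_apply, homotopy_apply hd, map_sub, map_smul, map_smul,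
        show i + (j + 1) = i + 1 + j by ring, iterComp, iterComp, Module.End.mul_apply,
        Module.End.mul_apply, pow_succ]
      module
    rw [h2]
    exact Submodule.sub_mem _ (smul_mem_spanSMul (by simp) _) (map_mem_spanSMul _ h1)

/-- If `h_j ⋯ h_{j+i-1}` maps a cycle to a boundary modulo `y_j, …, y_{j+i-1}`, then the cycle is
a boundary: the homotopies can be stripped off one at a time, by regularity of `y`. -/
lemma mem_range_of_iterComp_mem {n : ℕ} (hd : ∀ l, d * h l + h l * d = y l • 1)
    (hdd : ∀ x, d (d x) = 0)
    (hreg : ∀ l < n, ∀ S : Set ℕ, l ∉ S → ∀ x : G, y l • x ∈ spanSMul G y S → x ∈ spanSMul G y S)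
    {f : G} (hf : d f = 0) (i j : ℕ) (hij : j + i ≤ n)
    (hi : iterComp h j i f ∈ spanSMul G y (Set.Ico j (j + i)) ⊔ LinearMap.range d) :
    f ∈ LinearMap.range d := by
  induction i generalizing j with
  | zero => simpa [iterComp, spanSMul_empty] using hi
  | succ i ih =>
    refine ih (j + 1) (by omega) ?_
    have hu := d_iterComp_mem hd hf i (j + 1)
    rw [iterComp, Module.End.mul_apply] at hi
    generalize iterComp h (j + 1) i f = u at hi hu ⊢
    have hS : Set.Ico j (j + (i + 1)) = insert j (Set.Ico (j + 1) (j + 1 + i)) := by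
      ext l; simp only [Set.mem_Ico, Set.mem_insert_iff]; omega
    rw [hS] at hi
    have hj : j ∉ Set.Ico (j + 1) (j + 1 + i) := by simp
    generalize Set.Ico (j + 1) (j + 1 + i) = S at hi hu hj ⊢
    obtain ⟨a, ha, _, ⟨t, rfl⟩, hat⟩ := Submodule.mem_sup.1 hi
    obtain ⟨v, z, hz, rfl⟩ := exists_of_mem_spanSMul_insert ha
    -- `h_j (u - d v)` is a boundary modulo the remaining `y_l`,
    -- so `y_j (u - d v)` vanishes modulo them
    have key : y j • (u - d v) ∈ spanSMul G y S := by
      have h1 : y j • (u - d v) = d z + h j (d u) := by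
        have h2 : h j (u - d v) = z + d (t + h j v) := by
          rw [map_sub, ← hat, map_add, homotopy_apply hd]; abel
        have h3 := homotopy_apply hd j (u - d v)
        rw [h2, map_add, hdd, map_sub, hdd, sub_zero, add_zero] at h3
        rw [h3]; abel
      rw [h1]
      exact Submodule.add_mem _ (map_mem_spanSMul _ hz) (map_mem_spanSMul _ hu)
    have h4 := hreg j (by omega) S hj _ key
    exact Submodule.mem_sup.2 ⟨_, h4, d v, ⟨v, rfl⟩, by abel⟩

/-- Let `B` be a bilinear form for which `d` is self-adjoint up to the signs `σ`. Moving the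
homotopies from the first argument to the second one by one only changes the form by signs,
modulo the `y_l`. -/
lemma bilin_iterComp_sub_mem {n : ℕ} (hd : ∀ l, d * h l + h l * d = y l • 1)
    (hreg : ∀ l < n, ∀ S : Set ℕ, l ∉ S → ∀ r : R, y l * r ∈ Ideal.span (y '' S) →
      r ∈ Ideal.span (y '' S))
    (B : G →ₗ[R] G →ₗ[R] R) (σ : ℕ → R) {f g : G} (hf : d f = 0) (hg : d g = 0)
    (hB : ∀ j < n, B (d (iterComp h j (n - j) f)) (iterComp h 0 (j + 1) g) =
      σ j * B (iterComp h j (n - j) f) (d (iterComp h 0 (j + 1) g)))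
    (j : ℕ) (hj : j ≤ n) :
    B (iterComp h j (n - j) f) (iterComp h 0 j g) -
      (∏ l ∈ Finset.range j, σ l * (-1) ^ l) * B (iterComp h 0 n f) g ∈
        Ideal.span (y '' Set.Iio n) := by
  induction j with
  | zero => simp [iterComp]
  | succ j ih =>
    have ih := ih (by omega)
    set S : Set ℕ := Set.Iio n \ {j}
    have hSn : Ideal.span (y '' S) ≤ Ideal.span (y '' Set.Iio n) :=
      Ideal.span_mono (Set.image_mono Set.sdiff_subset)
    set u' := iterComp h (j + 1) (n - (j + 1)) f
    have hu : iterComp h j (n - j) f = h j u' := by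
      rw [show n - j = n - (j + 1) + 1 by omega]; rfl
    have hB := hB j (by omega)
    set v := iterComp h 0 j g
    set v' := iterComp h 0 (j + 1) g
    rw [hu] at hB ih
    have h1 : d u' ∈ spanSMul G y S := by
      refine spanSMul_mono ?_ (d_iterComp_mem hd hf (n - (j + 1)) (j + 1))
      intro l; simp only [Set.mem_Ico, S, Set.mem_sdiff, Set.mem_Iio, Set.mem_singleton_iff]; omega
    have h2 : d v' - (-1 : R) ^ j • y j • v ∈ spanSMul G y S := by
      have := d_iterComp_succ_sub_mem hd hg j 0
      rw [zero_add] at this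
      refine spanSMul_mono ?_ this
      intro l; simp only [Set.mem_Ico, S, Set.mem_sdiff, Set.mem_Iio, Set.mem_singleton_iff]; omega
    have h3 : B u' v' - σ j * (-1) ^ j * B (h j u') v ∈ Ideal.span (y '' S) := by
      refine hreg j (by omega) S (by simp [S]) _ ?_
      have e1 := mem_spanSMul_self.1 (map_mem_spanSMul (B.flip v') (map_mem_spanSMul (h j) h1))
      have e2 := mem_spanSMul_self.1 (map_mem_spanSMul (B (h j u')) h2)
      rw [homotopy_apply hd, map_sub, LinearMap.sub_apply, map_smul, LinearMap.smul_apply] at hB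
      simp only [LinearMap.flip_apply, map_sub, map_smul, smul_eq_mul] at e1 e2 hB
      have := Ideal.add_mem _ e1 (Ideal.mul_mem_left _ (σ j) e2)
      convert! this using 1
      linear_combination hB
    have h4 := Ideal.add_mem _ (hSn h3) (Ideal.mul_mem_left _ (σ j * (-1) ^ j) ih)
    rw [Finset.prod_range_succ]
    convert! h4 using 1
    ring

end Homotopy

/-! ### Ideals generated by powers of the variables -/

section Polynomial

variable {k : Type*} [Field k] {n : ℕ}

/-- The sequence `X_0^N, …, X_{n-1}^N`, continued by zeros. -/
def powVar (k : Type*) [Field k] (n N : ℕ) (l : ℕ) : MvPolynomial (Fin n) k :=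
  if hl : l < n then X ⟨l, hl⟩ ^ N else 0

lemma powVar_coe (N : ℕ) (l : Fin n) : powVar k n N l = X l ^ N := by
  simp [powVar]

lemma mem_span_powVar {N : ℕ} {S : Set ℕ} {r : MvPolynomial (Fin n) k} :
    r ∈ Ideal.span (powVar k n N '' S) ↔
      ∀ e : Fin n →₀ ℕ, coeff e r ≠ 0 → ∃ l : Fin n, (l : ℕ) ∈ S ∧ N ≤ e l := by
  have h1 : Ideal.span (powVar k n N '' S) = Ideal.span ((fun e => monomial e (1 : k)) ''
      ((fun l : Fin n => Finsupp.single l N) '' {l | (l : ℕ) ∈ S})) := by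
    apply le_antisymm
    · rw [Ideal.span_le]
      rintro _ ⟨l, hl, rfl⟩
      by_cases hln : l < n
      · refine Ideal.subset_span ⟨_, ⟨⟨l, hln⟩, hl, rfl⟩, ?_⟩
        simp [powVar, hln, X_pow_eq_monomial]
      · simp [powVar, hln]
    · refine Ideal.span_mono ?_
      rintro _ ⟨_, ⟨l, hl, rfl⟩, rfl⟩
      exact ⟨l, hl, by simp [powVar_coe, X_pow_eq_monomial]⟩
  rw [h1, mem_ideal_span_monomial_image]
  simp [mem_support_iff]

/-- The powers of the variables form a regular sequence in every order. -/
lemma powVar_regular {N : ℕ} {l : ℕ} (hl : l < n) {S : Set ℕ} (hlS : l ∉ S)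
    {r : MvPolynomial (Fin n) k} (hr : powVar k n N l * r ∈ Ideal.span (powVar k n N '' S)) :
    r ∈ Ideal.span (powVar k n N '' S) := by
  rw [mem_span_powVar] at hr ⊢
  intro e he
  obtain ⟨l', hl', h⟩ := hr (Finsupp.single ⟨l, hl⟩ N + e) (by
    simpa [powVar, hl, X_pow_eq_monomial, coeff_monomial_mul] using he)
  refine ⟨l', hl', ?_⟩
  have : (⟨l, hl⟩ : Fin n) ≠ l' := by rintro rfl; exact hlS hl'
  simpa [Finsupp.single_apply, this] using h

/-- The exponent `(N-1, …, N-1)` of the socle generator of `R / (X_0^N, …, X_{n-1}^N)`. -/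
def socleExp (n N : ℕ) : Fin n →₀ ℕ := Finsupp.equivFunOnFinite.symm fun _ => N - 1

lemma coeff_socleExp_of_mem {N : ℕ} (hN : 0 < N) {S : Set ℕ} {r : MvPolynomial (Fin n) k}
    (hr : r ∈ Ideal.span (powVar k n N '' S)) : coeff (socleExp n N) r = 0 := by
  by_contra h
  obtain ⟨l, -, hl⟩ := mem_span_powVar.1 hr _ h
  simp [socleExp] at hl
  omega

/-- The ring `R / (X_0^N, …, X_{n-1}^N)` is Gorenstein: the coefficient of the socle monomial
induces a perfect pairing on it. -/
lemma mem_span_powVar_of_coeff {N : ℕ} {r : MvPolynomial (Fin n) k}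
    (hr : ∀ t, coeff (socleExp n N) (t * r) = 0) :
    r ∈ Ideal.span (powVar k n N '' Set.Iio n) := by
  rw [mem_span_powVar]
  intro e he
  by_contra! hlt
  have hle : e ≤ socleExp n N := fun l => by
    have := hlt l l.2; simp [socleExp]; omega
  have := hr (monomial (socleExp n N - e) 1)
  rw [coeff_monomial_mul', if_pos tsub_le_self, tsub_tsub_cancel_of_le hle, one_mul] at this
  exact he this

lemma mem_spanSMul_iff_repr {ι R G : Type*} [Fintype ι] [CommRing R] [AddCommGroup G] [Module R G]
    (b : Module.Basis ι R G) (y : ℕ → R) (S : Set ℕ) (x : G) :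
    x ∈ spanSMul G y S ↔ ∀ i, b.repr x i ∈ Ideal.span (y '' S) := by
  refine ⟨fun hx i => mem_spanSMul_self.1 (map_mem_spanSMul (b.coord i) hx), fun hx => ?_⟩
  rw [← b.sum_repr x]
  exact Submodule.sum_mem _ fun i _ => Submodule.smul_mem_smul (hx i) trivial

lemma powVar_smul_regular {ι G : Type*} [Fintype ι] [AddCommGroup G]
    [Module (MvPolynomial (Fin n) k) G] (b : Module.Basis ι (MvPolynomial (Fin n) k) G)
    {N l : ℕ} (hl : l < n) {S : Set ℕ} (hlS : l ∉ S) {x : G}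
    (hx : powVar k n N l • x ∈ spanSMul G (powVar k n N) S) :
    x ∈ spanSMul G (powVar k n N) S := by
  rw [mem_spanSMul_iff_repr b] at hx ⊢
  intro i
  have := hx i
  rw [map_smul, Finsupp.smul_apply, smul_eq_mul] at this
  exact powVar_regular hl hlS this

end Polynomial

/-! ### Gradings given by homogeneous bases -/

section Lift

variable {k : Type*} [Field k] {D : Type*} [AddCommGroup D]
  {A : Type*} [AddCommGroup A] [Module k A] {B : Type*} [AddCommGroup B] [Module k B]

/-- A homogeneous element in the image of a homogeneous map of degree `δ` is the image of a
homogeneous element. -/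
lemma exists_homogeneous_lift {𝓐 : D → Submodule k A} {𝓑 : D → Submodule k B}
    (hA : ⨆ e, 𝓐 e = ⊤) (hB : iSupIndep 𝓑) (f : A →ₗ[k] B) (δ : D)
    (hf : ∀ e, ∀ x ∈ 𝓐 e, f x ∈ 𝓑 (e + δ)) (e : D) (x : A) (hx : f x ∈ 𝓑 (e + δ)) :
    ∃ x' ∈ 𝓐 e, f x' = f x := by
  have hx' : x ∈ 𝓐 e ⊔ ⨆ (e') (_ : e' ≠ e), 𝓐 e' := by
    rw [← iSup_split_single, hA]; trivial
  obtain ⟨a, ha, a', ha', rfl⟩ := Submodule.mem_sup.1 hx'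
  refine ⟨a, ha, ?_⟩
  have h1 : (⨆ (e') (_ : e' ≠ e), 𝓐 e') ≤ (⨆ (c) (_ : c ≠ e + δ), 𝓑 c).comap f := by
    refine iSup₂_le fun e' he' z hz => ?_
    have : e' + δ ≠ e + δ := fun h => he' (add_right_cancel h)
    exact Submodule.mem_iSup_of_mem (e' + δ) (Submodule.mem_iSup_of_mem this (hf e' z hz))
  have h2 : f a' ∈ 𝓑 (e + δ) := by
    have := Submodule.sub_mem _ hx (hf e a ha)
    rwa [map_add, add_sub_cancel_left] at this
  have h3 : f a' = 0 := Submodule.disjoint_def.1 (hB (e + δ)) _ h2 (h1 ha')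
  rw [map_add, h3, add_zero]

end Lift

section SpanOfBasis

variable {k : Type*} [Field k] {n : ℕ} {D : Type*} [AddCommGroup D] {w : Fin n → D} {ι : Type*}
  {G : Type*} [AddCommGroup G] [Module k G] [Module (MvPolynomial (Fin n) k) G]

/-- In a graded module, an `R`-multiple of a homogeneous element is a sum of homogeneous
elements. -/
lemma smul_mem_iSup {𝓐 : D → Submodule k G}
    (hA : ∀ t e, ∀ r ∈ weightedHomogeneousSubmodule k w t, ∀ x ∈ 𝓐 e, r • x ∈ 𝓐 (t + e))
    (r : MvPolynomial (Fin n) k) {e : D} {x : G} (hx : x ∈ 𝓐 e) : r • x ∈ ⨆ e, 𝓐 e := by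
  rw [r.as_sum, Finset.sum_smul]
  exact Submodule.sum_mem _ fun v _ => Submodule.mem_iSup_of_mem _
    (hA _ e _ (isWeightedHomogeneous_monomial w v _ rfl) x hx)

lemma iSup_eq_top_of_basis {𝓐 : D → Submodule k G}
    (hA : ∀ t e, ∀ r ∈ weightedHomogeneousSubmodule k w t, ∀ x ∈ 𝓐 e, r • x ∈ 𝓐 (t + e))
    [Fintype ι] {deg : ι → D} (b : Module.Basis ι (MvPolynomial (Fin n) k) G)
    (hb : ∀ i, b i ∈ 𝓐 (deg i)) :
    ⨆ e, 𝓐 e = ⊤ := by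
  rw [eq_top_iff]
  intro x _
  rw [← b.sum_repr x]
  exact Submodule.sum_mem _ fun i _ => smul_mem_iSup hA _ (hb i)

end SpanOfBasis

section BasisGrading

variable {k : Type*} [Field k] {n : ℕ} {D : Type*} [AddCommGroup D] {w : Fin n → D}
  {ι : Type*}
  {G : Type*} [AddCommGroup G] [Module k G] [Module (MvPolynomial (Fin n) k) G]
  [IsScalarTower k (MvPolynomial (Fin n) k) G]
  {κ : Type*}
  {H : Type*} [AddCommGroup H] [Module k H] [Module (MvPolynomial (Fin n) k) H]
  [IsScalarTower k (MvPolynomial (Fin n) k) H]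

/-- The grading of a free module for which the basis element `b i` is homogeneous of degree
`deg i`: an element has degree `e` if its `i`-th coordinate has degree `e - deg i` for all `i`. -/
def basisGrading (w : Fin n → D) (b : Module.Basis ι (MvPolynomial (Fin n) k) G) (deg : ι → D)
    (e : D) : Submodule k G where
  carrier := {x | ∀ i, b.repr x i ∈ weightedHomogeneousSubmodule k w (e - deg i)}
  zero_mem' i := by simp only [map_zero, Finsupp.zero_apply]; exact Submodule.zero_mem _
  add_mem' hx hy i := by
    simp only [map_add, Finsupp.add_apply]; exact Submodule.add_mem _ (hx i) (hy i)
  smul_mem' c x hx i := by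
    rw [← algebraMap_smul (MvPolynomial (Fin n) k) c x, map_smul, Finsupp.smul_apply, smul_eq_mul,
      ← Algebra.smul_def]
    exact Submodule.smul_mem _ c (hx i)

variable {b : Module.Basis ι (MvPolynomial (Fin n) k) G} {deg : ι → D}
  {b' : Module.Basis κ (MvPolynomial (Fin n) k) H} {deg' : κ → D}

lemma mem_basisGrading {e : D} {x : G} : x ∈ basisGrading w b deg e ↔
    ∀ i, b.repr x i ∈ weightedHomogeneousSubmodule k w (e - deg i) := Iff.rfl

lemma basis_mem_basisGrading (i : ι) : b i ∈ basisGrading w b deg (deg i) := by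
  classical
  intro j
  rw [b.repr_self, Finsupp.single_apply]
  split_ifs with h
  · subst h
    rw [sub_self]
    exact isWeightedHomogeneous_one k w
  · exact Submodule.zero_mem _

lemma smul_mem_basisGrading {r : MvPolynomial (Fin n) k} {t e : D}
    (hr : r ∈ weightedHomogeneousSubmodule k w t) {x : G} (hx : x ∈ basisGrading w b deg e) :
    r • x ∈ basisGrading w b deg (t + e) := by
  intro i
  rw [map_smul, Finsupp.smul_apply, smul_eq_mul, add_sub_assoc]
  exact IsWeightedHomogeneous.mul hr (hx i)

lemma iSup_basisGrading [Fintype ι] : ⨆ e, basisGrading w b deg e = ⊤ :=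
  iSup_eq_top_of_basis (fun _ _ _ hr _ hx => smul_mem_basisGrading hr hx) b
    basis_mem_basisGrading

lemma iSupIndep_basisGrading : iSupIndep (basisGrading w b deg) := by
  classical
  intro e
  rw [Submodule.disjoint_def]
  intro x hx hx'
  refine b.repr.injective (Finsupp.ext fun i => ?_)
  rw [map_zero, Finsupp.zero_apply]
  let φ : G →ₗ[k] MvPolynomial (Fin n) k :=
    weightedHomogeneousComponent w (e - deg i) ∘ₗ (b.coord i).restrictScalars k
  have h1 : (⨆ (e') (_ : e' ≠ e), basisGrading w b deg e') ≤ LinearMap.ker φ := by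
    refine iSup₂_le fun e' he' z hz => ?_
    rw [LinearMap.mem_ker]
    exact (weightedHomogeneousComponent_of_mem (hz i)).trans
      (if_neg fun h => he' (sub_left_injective h).symm)
  have h2 : φ x = b.repr x i :=
    (weightedHomogeneousComponent_of_mem (hx i)).trans (if_pos rfl)
  rw [← h2]
  exact h1 hx'

lemma map_mem_basisGrading [Fintype ι] (f : G →ₗ[MvPolynomial (Fin n) k] H) (δ : D)
    (hf : ∀ i, f (b i) ∈ basisGrading w b' deg' (deg i + δ)) {e : D} {x : G}
    (hx : x ∈ basisGrading w b deg e) : f x ∈ basisGrading w b' deg' (e + δ) := by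
  rw [← b.sum_repr x, map_sum]
  refine Submodule.sum_mem _ fun i _ => ?_
  rw [map_smul]
  convert! smul_mem_basisGrading (hx i) (hf i) using 2
  abel

end BasisGrading

section GradedFree

variable {k : Type*} [Field k] {n : ℕ} {w : Fin n → ℤ}
  {F : Type*} [AddCommGroup F] [Module k F] [Module (MvPolynomial (Fin n) k) F]
  [IsScalarTower k (MvPolynomial (Fin n) k) F] {𝓕 : ℤ → Submodule k F}

lemma IsGradedModule.smul_mem {M : Type*} [AddCommGroup M] [Module k M]
    [Module (MvPolynomial (Fin n) k) M] {𝓜 : ℤ → Submodule k M} (h : IsGradedModule w 𝓜)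
    (t e : ℤ) (r : MvPolynomial (Fin n) k) (hr : r ∈ weightedHomogeneousSubmodule k w t) (x : M)
    (hx : x ∈ 𝓜 e) : r • x ∈ 𝓜 (t + e) :=
  h.gradedSMul.smul_mem hr hx

/-- The grading of a graded free module is the one given by any of its homogeneous bases. -/
lemma IsGradedFree.exists_eq_basisGrading (h : IsGradedFree w 𝓕) :
    ∃ (r : ℕ) (b : Module.Basis (Fin r) (MvPolynomial (Fin n) k) F) (a : Fin r → ℤ),
      ∀ e, 𝓕 e = basisGrading w b a e := by
  obtain ⟨r, b, a, hb⟩ := h.exists_basis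
  refine ⟨r, b, a, fun e => ?_⟩
  have hle : ∀ e, basisGrading w b a e ≤ 𝓕 e := fun e x hx => by
    rw [← b.sum_repr x]
    refine Submodule.sum_mem _ fun i _ => ?_
    have := h.isGradedModule.smul_mem _ _ _ (hx i) _ (hb i)
    rwa [sub_add_cancel] at this
  refine le_antisymm (fun x hx => ?_) (hle e)
  obtain ⟨x', hx', h'⟩ := exists_homogeneous_lift (𝓐 := basisGrading w b a) (𝓑 := 𝓕)
    iSup_basisGrading h.isGradedModule.isInternal.submodule_iSupIndep LinearMap.id 0
    (fun e x hx => by simpa using hle e hx) e x (by simpa using hx)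
  simp only [LinearMap.id_apply] at h'
  exact h' ▸ hx'

lemma rdualGrading_eq_basisGrading {r : ℕ}
    {b : Module.Basis (Fin r) (MvPolynomial (Fin n) k) F} {a : Fin r → ℤ}
    (h : ∀ e, 𝓕 e = basisGrading w b a e) (e : ℤ) :
    rdualGrading w 𝓕 e = basisGrading w b.dualBasis (fun j => ∑ l, w l - a j) e := by
  ext φ
  rw [mem_basisGrading]
  simp only [Module.Basis.dualBasis_repr]
  constructor
  · intro hφ j
    have h1 : b j ∈ 𝓕 (a j) := by rw [h]; exact basis_mem_basisGrading j
    convert! hφ (a j) (b j) h1 using 1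
    rw [twist]; congr 1; ring
  · intro hφ c x hx
    rw [h] at hx
    rw [← b.sum_repr x, map_sum]
    refine Submodule.sum_mem _ fun j _ => ?_
    rw [map_smul, smul_eq_mul]
    convert! IsWeightedHomogeneous.mul (hx j) (hφ j) using 1
    rw [twist, mem_weightedHomogeneousSubmodule]; congr! 1; ring

end GradedFree

/-! ### Homogeneous null-homotopies -/

section Bigraded

variable {k : Type*} [Field k] {n : ℕ} {w : Fin n → ℤ} {ι : Type*}
  {G : Type*} [AddCommGroup G] [Module k G] [Module (MvPolynomial (Fin n) k) G]
  [IsScalarTower k (MvPolynomial (Fin n) k) G]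
  {b : Module.Basis ι (MvPolynomial (Fin n) k) G} {deg : ι → ℤ × ℤ}

/-- The weights of the variables for the grading by pairs (homological degree, internal degree):
the variables have homological degree `0`. -/
def biweight (w : Fin n → ℤ) (l : Fin n) : ℤ × ℤ := (0, w l)

lemma weight_biweight (v : Fin n →₀ ℕ) :
    Finsupp.weight (biweight w) v = (0, Finsupp.weight w v) := by
  simp only [Finsupp.weight_apply, biweight, Finsupp.sum]
  ext <;> simp [Prod.fst_sum, Prod.snd_sum]

lemma mem_biweight_iff {r : MvPolynomial (Fin n) k} {e : ℤ × ℤ} :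
    r ∈ weightedHomogeneousSubmodule k (biweight w) e ↔
      r ∈ weightedHomogeneousSubmodule k w e.2 ∧ (e.1 ≠ 0 → r = 0) := by
  simp only [mem_weightedHomogeneousSubmodule, IsWeightedHomogeneous, weight_biweight]
  constructor
  · refine fun h => ⟨fun v hv => (congrArg Prod.snd (h hv)), fun he => ?_⟩
    ext v
    by_contra hv
    exact he (congrArg Prod.fst (h hv)).symm
  · rintro ⟨h1, h2⟩ v hv
    refine Prod.ext ?_ (h1 hv)
    by_contra he
    exact hv (by rw [h2 (Ne.symm he), coeff_zero])

lemma repr_eq_zero_of_mem {p c : ℤ} {x : G} (hx : x ∈ basisGrading (biweight w) b deg (p, c))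
    {i : ι} (hi : (deg i).1 ≠ p) : b.repr x i = 0 :=
  (mem_biweight_iff.1 (hx i)).2 (by simpa [sub_eq_zero] using hi.symm)

variable [Fintype ι]

/-- If `y` kills the homology of a complex of free modules that is exact in positive degrees, then
multiplication by `y` is null-homotopic, by a homotopy that is homogeneous. -/
theorem exists_homotopy (hdeg : ∀ i, 0 ≤ (deg i).1)
    (d : Module.End (MvPolynomial (Fin n) k) G)
    (hd : ∀ i, d (b i) ∈ basisGrading (biweight w) b deg (deg i + (-1, 0)))
    (hdd : ∀ x, d (d x) = 0) (y : MvPolynomial (Fin n) k) (t : ℤ)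
    (hy : y ∈ weightedHomogeneousSubmodule k w t)
    (hexact : ∀ p c x, 0 < p → x ∈ basisGrading (biweight w) b deg (p, c) → d x = 0 →
      x ∈ LinearMap.range d)
    (hzero : ∀ c x, x ∈ basisGrading (biweight w) b deg (0, c) → y • x ∈ LinearMap.range d) :
    ∃ h : Module.End (MvPolynomial (Fin n) k) G,
      (∀ i, h (b i) ∈ basisGrading (biweight w) b deg (deg i + (1, t))) ∧
        d * h + h * d = y • 1 := by
  -- construct the homotopy on the terms of homological degree less than `p`, by induction on `p`
  have main : ∀ p : ℕ, ∃ h : Module.End (MvPolynomial (Fin n) k) G,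
      (∀ i, h (b i) ∈ basisGrading (biweight w) b deg (deg i + (1, t))) ∧
        ∀ i, (deg i).1 < p → d (h (b i)) + h (d (b i)) = y • b i := by
    intro p
    induction p with
    | zero =>
      exact ⟨0, fun i => Submodule.zero_mem _, fun i hi => absurd (hdeg i) (by simpa using hi)⟩
    | succ p ih =>
      obtain ⟨h, hh, hp⟩ := ih
      have hlow : ∀ q c x, q < (p : ℤ) → x ∈ basisGrading (biweight w) b deg (q, c) →
          d (h x) + h (d x) = y • x := by
        intro q c x hq hx
        rw [← b.sum_repr x]
        simp only [map_sum, map_smul, Finset.smul_sum, ← Finset.sum_add_distrib, ← smul_add]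
        refine Finset.sum_congr rfl fun i _ => ?_
        by_cases hi : (deg i).1 = q
        · rw [hp i (hi ▸ hq), smul_comm]
        · rw [repr_eq_zero_of_mem hx hi, zero_smul, zero_smul, smul_zero]
      -- `y • b i - h (d (b i))` is a boundary; a homogeneous preimage is the new value of `h`
      have hlift : ∀ i, ∃ g, (deg i).1 = p →
          g ∈ basisGrading (biweight w) b deg (deg i + (1, t)) ∧
            d g = y • b i - h (d (b i)) := by
        intro i
        by_cases hi : (deg i).1 = p
        swap
        · exact ⟨0, fun h => absurd h hi⟩
        have hdeg' : deg i = ((p : ℤ), (deg i).2) := Prod.ext hi rfl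
        have hyb : y • b i ∈ basisGrading (biweight w) b deg (deg i + (1, t) + (-1, 0)) := by
          have h1 : y ∈ weightedHomogeneousSubmodule k (biweight w) (0, t) :=
            mem_biweight_iff.2 ⟨hy, fun h => absurd rfl h⟩
          have h2 := smul_mem_basisGrading (b := b) (deg := deg) h1 (basis_mem_basisGrading i)
          convert! h2 using 2
          ext <;> simp [add_comm]
        have hhd : h (d (b i)) ∈ basisGrading (biweight w) b deg (deg i + (1, t) + (-1, 0)) := by
          convert! map_mem_basisGrading h (1, t) hh (hd i) using 2
          abel
        have hz := Submodule.sub_mem _ hyb hhd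
        have hdb := hd i
        rw [hdeg', Prod.mk_add_mk] at hdb
        have hrange : y • b i - h (d (b i)) ∈ LinearMap.range d := by
          rcases Nat.eq_zero_or_pos p with rfl | hpos
          · have h0 : d (b i) = 0 := by
              refine b.repr.injective (Finsupp.ext fun j => ?_)
              rw [map_zero, Finsupp.zero_apply]
              refine repr_eq_zero_of_mem hdb ?_
              have := hdeg j
              simp only [Nat.cast_zero]; omega
            rw [h0, map_zero, sub_zero]
            refine hzero (deg i).2 _ ?_
            have := basis_mem_basisGrading (w := biweight w) (b := b) (deg := deg) i
            rwa [hdeg'] at this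
          · rw [hdeg'] at hz
            simp only [Prod.mk_add_mk] at hz
            refine hexact _ _ _ ?_ hz ?_
            · omega
            · have h1 := hlow _ _ _ (by omega) hdb
              rw [hdd, map_zero, add_zero] at h1
              rw [map_sub, map_smul, h1, sub_self]
        obtain ⟨x, hx⟩ := hrange
        obtain ⟨g, hg, hg'⟩ := exists_homogeneous_lift
          (𝓐 := basisGrading (biweight w) b deg) (𝓑 := basisGrading (biweight w) b deg)
          iSup_basisGrading iSupIndep_basisGrading (d.restrictScalars k) (-1, 0)
          (fun e x hx => map_mem_basisGrading d _ hd hx) (deg i + (1, t)) x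
          (by rw [LinearMap.restrictScalars_apply, hx]; exact hz)
        exact ⟨g, fun _ => ⟨hg, hg'.trans hx⟩⟩
      choose g hg using hlift
      classical
      let h' : Module.End (MvPolynomial (Fin n) k) G :=
        b.constr k fun i => if (deg i).1 = p then g i else h (b i)
      have hb : ∀ i, h' (b i) = if (deg i).1 = p then g i else h (b i) :=
        fun i => b.constr_basis k _ i
      have hagree : ∀ q c x, q < (p : ℤ) → x ∈ basisGrading (biweight w) b deg (q, c) →
          h' x = h x := by
        intro q c x hq hx
        rw [← b.sum_repr x]
        simp only [map_sum, map_smul]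
        refine Finset.sum_congr rfl fun i _ => ?_
        by_cases hi : (deg i).1 = q
        · rw [hb, if_neg (by omega)]
        · rw [repr_eq_zero_of_mem hx hi, zero_smul, zero_smul]
      refine ⟨h', fun i => ?_, fun i hi => ?_⟩
      · rw [hb]
        split_ifs with hi
        · exact (hg i hi).1
        · exact hh i
      · have hdb : d (b i) ∈ basisGrading (biweight w) b deg ((deg i).1 - 1, (deg i).2) := by
          convert! hd i using 2
          ext <;> simp [sub_eq_add_neg]
        rw [hagree _ _ _ (by push_cast at hi; omega) hdb, hb]
        split_ifs with hip
        · rw [(hg i hip).2, sub_add_cancel]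
        · exact hp i (by push_cast at hi; omega)
  obtain ⟨p, hp⟩ := (Set.finite_range fun i => (deg i).1).bddAbove
  obtain ⟨h, hh, hh'⟩ := main (p.toNat + 1)
  refine ⟨h, hh, b.ext fun i => ?_⟩
  exact hh' i (by have := hp ⟨i, rfl⟩; simp only at this; omega)

lemma iterComp_mem_basisGrading {h : ℕ → Module.End (MvPolynomial (Fin n) k) G} {t : ℕ → ℤ}
    (hh : ∀ l i, h l (b i) ∈ basisGrading (biweight w) b deg (deg i + (1, t l))) (i j : ℕ)
    {p c : ℤ} {x : G} (hx : x ∈ basisGrading (biweight w) b deg (p, c)) :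
    iterComp h j i x ∈ basisGrading (biweight w) b deg
      (p + i, c + ∑ l ∈ Finset.Ico j (j + i), t l) := by
  induction i generalizing j with
  | zero => simpa [iterComp] using hx
  | succ i ih =>
    have := map_mem_basisGrading (h j) (1, t j) (hh j) (ih (j + 1))
    rw [iterComp, Module.End.mul_apply]
    convert! this using 2
    rw [Finset.sum_eq_sum_Ico_succ_bot (by omega : j < j + (i + 1)),
      show j + (i + 1) = j + 1 + i by ring]
    ext
    · simp; ring
    · simp; ring

end Bigraded

/-! ### Graded modules of finite length -/

section FiniteLength

variable {k : Type*} [Field k] {n : ℕ} {w : Fin n → ℤ}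
  {M : Type*} [AddCommGroup M] [Module k M] [Module (MvPolynomial (Fin n) k) M]
  {𝓜 : ℤ → Submodule k M}

lemma weight_nonneg (hw : ∀ l, 0 < w l) (v : Fin n →₀ ℕ) : 0 ≤ Finsupp.weight w v := by
  rw [Finsupp.weight_apply]
  exact Finset.sum_nonneg fun l _ => nsmul_nonneg (hw l).le _

/-- In a graded Artinian module, `X_l ^ N • x` is a multiple of `X_l ^ (N + 1) • x` for large `N`.
For homogeneous `x` this forces `X_l ^ N • x = 0`, since `X_l` has positive degree. -/
lemma exists_pow_smul_eq_zero [IsArtinian (MvPolynomial (Fin n) k) M] (hw : ∀ l, 0 < w l)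
    (hM : IsGradedModule w 𝓜) {c : ℤ} {x : M} (hx : x ∈ 𝓜 c) (l : Fin n) :
    ∃ N : ℕ, (X l : MvPolynomial (Fin n) k) ^ N • x = 0 := by
  obtain ⟨N, ⟨y, hy⟩, hN⟩ := IsArtinian.exists_pow_succ_smul_dvd (X l : MvPolynomial (Fin n) k)
    (⟨x, Submodule.mem_span_singleton_self x⟩ : Submodule.span (MvPolynomial (Fin n) k) {x})
  obtain ⟨r, rfl⟩ := Submodule.mem_span_singleton.1 hy
  have hN : X l ^ (N + 1) • r • x = (X l : MvPolynomial (Fin n) k) ^ N • x :=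
    congrArg Subtype.val hN
  have hX : ∀ j : ℕ, (X l : MvPolynomial (Fin n) k) ^ j ∈
      weightedHomogeneousSubmodule k w (j • w l) :=
    fun j => (isWeightedHomogeneous_X k w l).pow j
  refine ⟨N, Submodule.disjoint_def.1
    (hM.isInternal.submodule_iSupIndep (N • w l + c)) _ (hM.smul_mem _ _ _ (hX N) _ hx) ?_⟩
  -- all components of `X_l ^ (N + 1) • r • x` have degree at least `(N + 1) * w l + c`
  rw [← hN, smul_smul, r.as_sum, Finset.mul_sum, Finset.sum_smul]
  refine Submodule.sum_mem _ fun v _ => ?_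
  have h1 := hM.smul_mem _ _ _ (IsWeightedHomogeneous.mul (hX (N + 1))
    (isWeightedHomogeneous_monomial w v (coeff v r) rfl)) _ hx
  refine Submodule.mem_iSup_of_mem _ (Submodule.mem_iSup_of_mem ?_ h1)
  have := weight_nonneg hw v
  have := hw l
  rw [succ_nsmul]
  omega

variable {F : Type*} [AddCommGroup F] [Module (MvPolynomial (Fin n) k) F] {ι : Type*} [Fintype ι]

lemma exists_uniform_pow_smul_eq_zero [IsArtinian (MvPolynomial (Fin n) k) M] (hw : ∀ l, 0 < w l)
    (hM : IsGradedModule w 𝓜) (π : F →ₗ[MvPolynomial (Fin n) k] M) (hπ : Function.Surjective π)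
    (b : Module.Basis ι (MvPolynomial (Fin n) k) F) (a : ι → ℤ) (hb : ∀ i, π (b i) ∈ 𝓜 (a i)) :
    ∃ N : ℕ, 0 < N ∧ ∀ (l : Fin n) (x : M), (X l : MvPolynomial (Fin n) k) ^ N • x = 0 := by
  choose e he using fun i l => exists_pow_smul_eq_zero hw hM (hb i) l
  obtain ⟨N, hN⟩ := (Set.finite_range fun p : ι × Fin n => e p.1 p.2).bddAbove
  refine ⟨N + 1, by omega, fun l x => ?_⟩
  obtain ⟨f, rfl⟩ := hπ x
  rw [← b.sum_repr f, map_sum, Finset.smul_sum]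
  refine Finset.sum_eq_zero fun i _ => ?_
  have hle : e i l ≤ N := hN ⟨(i, l), rfl⟩
  rw [map_smul, smul_comm, show N + 1 = (N + 1 - e i l) + e i l by omega, pow_add, mul_smul, he,
    smul_zero, smul_zero]

lemma finite_of_pow_smul_eq_zero [IsScalarTower k (MvPolynomial (Fin n) k) M]
    (π : F →ₗ[MvPolynomial (Fin n) k] M) (hπ : Function.Surjective π)
    (b : Module.Basis ι (MvPolynomial (Fin n) k) F) {N : ℕ}
    (hN : ∀ (l : Fin n) (x : M), (X l : MvPolynomial (Fin n) k) ^ N • x = 0) :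
    Module.Finite k M := by
  let g : (Fin n → Fin N) × ι → M := fun p =>
    monomial (Finsupp.equivFunOnFinite.symm fun l => (p.1 l : ℕ)) (1 : k) • π (b p.2)
  refine ⟨⟨(Set.finite_range g).toFinset, ?_⟩⟩
  rw [Set.Finite.coe_toFinset, eq_top_iff]
  intro x _
  obtain ⟨f, rfl⟩ := hπ x
  rw [← b.sum_repr f, map_sum]
  refine Submodule.sum_mem _ fun i _ => ?_
  rw [map_smul, (b.repr f i).as_sum, Finset.sum_smul]
  refine Submodule.sum_mem _ fun v _ => ?_
  by_cases hv : ∃ l, N ≤ v l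
  · obtain ⟨l, hl⟩ := hv
    have h1 : monomial v (coeff v (b.repr f i)) =
        monomial (v - Finsupp.single l N) (coeff v (b.repr f i)) * X l ^ N := by
      rw [X_pow_eq_monomial, monomial_mul, mul_one, tsub_add_cancel_of_le]
      exact Finsupp.single_le_iff.2 hl
    rw [h1, mul_smul, hN, smul_zero]
    exact Submodule.zero_mem _
  · push Not at hv
    have h1 : monomial v (coeff v (b.repr f i)) = coeff v (b.repr f i) • monomial v (1 : k) := by
      rw [smul_monomial, smul_eq_mul, mul_one]
    rw [h1, smul_assoc]
    refine Submodule.smul_mem _ _ (Submodule.subset_span ⟨(fun l => ⟨v l, hv l⟩, i), ?_⟩)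
    have h2 : Finsupp.equivFunOnFinite.symm (fun l => v l) = v := Finsupp.ext fun _ => rfl
    simp only [g, h2]

end FiniteLength

/-! ### The total module of a self-dual resolution -/

section Total

variable {k : Type*} [Field k] {n m : ℕ} {M : Type*} [AddCommGroup M]
  [Module (MvPolynomial (Fin n) k) M]
  {F : Fin (m + 1) → Type*} [∀ i, AddCommGroup (F i)] [∀ i, Module (MvPolynomial (Fin n) k) (F i)]
  {π : F 0 →ₗ[MvPolynomial (Fin n) k] M}
  {ψ : ∀ i : Fin m, F i.succ →ₗ[MvPolynomial (Fin n) k] F i.castSucc}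
  {μ : Module.Dual (MvPolynomial (Fin n) k) (F (Fin.last m)) →ₗ[MvPolynomial (Fin n) k]
    F (Fin.last m)}

/-- The direct sum of all the modules `F_i` and `F_i^∨` of the resolution. -/
abbrev Total (k : Type*) [Field k] (n : ℕ) {m : ℕ} (F : Fin (m + 1) → Type*)
    [∀ i, AddCommGroup (F i)] [∀ i, Module (MvPolynomial (Fin n) k) (F i)] :=
  (∀ i, F i) × (∀ i, Module.Dual (MvPolynomial (Fin n) k) (F i))

/-- The differential of the resolution, as one endomorphism of the direct sum of its terms. -/
def totalD (ψ : ∀ i : Fin m, F i.succ →ₗ[MvPolynomial (Fin n) k] F i.castSucc)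
    (μ : Module.Dual (MvPolynomial (Fin n) k) (F (Fin.last m)) →ₗ[MvPolynomial (Fin n) k]
      F (Fin.last m)) : Module.End (MvPolynomial (Fin n) k) (Total k n F) :=
  LinearMap.prod
    (LinearMap.pi (Fin.lastCases
      (motive := fun i => Total k n F →ₗ[MvPolynomial (Fin n) k] F i)
      (μ ∘ₗ LinearMap.proj (Fin.last m) ∘ₗ LinearMap.snd _ _ _)
      fun i => ψ i ∘ₗ LinearMap.proj i.succ ∘ₗ LinearMap.fst _ _ _))
    (LinearMap.pi (Fin.cases
      (motive := fun i => Total k n F →ₗ[MvPolynomial (Fin n) k]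
        Module.Dual (MvPolynomial (Fin n) k) (F i))
      0 fun i => (ψ i).dualMap ∘ₗ LinearMap.proj i.castSucc ∘ₗ LinearMap.snd _ _ _))

lemma totalD_fst_last (x : Total k n F) :
    (totalD ψ μ x).1 (Fin.last m) = μ (x.2 (Fin.last m)) := by
  simp [totalD]

lemma totalD_fst_castSucc (x : Total k n F) (i : Fin m) :
    (totalD ψ μ x).1 i.castSucc = ψ i (x.1 i.succ) := by
  simp [totalD]

lemma totalD_snd_zero (x : Total k n F) : (totalD ψ μ x).2 0 = 0 := rfl

lemma totalD_snd_succ (x : Total k n F) (i : Fin m) :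
    (totalD ψ μ x).2 i.succ = (ψ i).dualMap (x.2 i.castSucc) := rfl

lemma totalD_fst_mem_imAt (x : Total k n F) (i : Fin (m + 1)) :
    (totalD ψ μ x).1 i ∈ imAt ψ μ i := by
  induction i using Fin.lastCases with
  | last => simp [totalD_fst_last, imAt]
  | cast i => simp [totalD_fst_castSucc, imAt]

lemma totalD_snd_mem_imAtDual (x : Total k n F) (i : Fin (m + 1)) :
    (totalD ψ μ x).2 i ∈ imAtDual ψ i := by
  induction i using Fin.cases with
  | zero => exact Submodule.zero_mem _
  | succ i => exact ⟨_, rfl⟩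

lemma totalD_eq_zero_iff (x : Total k n F) : totalD ψ μ x = 0 ↔
    (∀ i : Fin m, x.1 i.succ ∈ kerAt π ψ i.succ) ∧ ∀ i, x.2 i ∈ kerAtDual ψ μ i := by
  constructor
  · refine fun h => ⟨fun i => ?_, fun i => ?_⟩
    · change ψ i (x.1 i.succ) = 0
      rw [← totalD_fst_castSucc (μ := μ), h]; rfl
    · induction i using Fin.lastCases with
      | last =>
        have : μ (x.2 (Fin.last m)) = 0 := by rw [← totalD_fst_last (ψ := ψ), h]; rfl
        simpa [kerAtDual] using this
      | cast i =>
        have : (ψ i).dualMap (x.2 i.castSucc) = 0 := by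
          rw [← totalD_snd_succ (μ := μ), h]; rfl
        simpa [kerAtDual] using this
  · rintro ⟨h1, h2⟩
    refine Prod.ext (funext fun i => ?_) (funext fun i => ?_)
    · induction i using Fin.lastCases with
      | last => simpa [totalD_fst_last, kerAtDual] using h2 (Fin.last m)
      | cast i => rw [totalD_fst_castSucc]; exact h1 i
    · induction i using Fin.cases with
      | zero => rfl
      | succ i => rw [totalD_snd_succ]; simpa [kerAtDual] using h2 i.castSucc

/-- The homology of the total module is `M`, in homological degree `0`. -/
lemma mem_range_totalD_iff (hexact : ∀ i, imAt ψ μ i = kerAt π ψ i)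
    (hexact' : ∀ i, imAtDual ψ i = kerAtDual ψ μ i) (x : Total k n F) :
    x ∈ LinearMap.range (totalD ψ μ) ↔ totalD ψ μ x = 0 ∧ π (x.1 0) = 0 := by
  rw [totalD_eq_zero_iff (π := π)]
  constructor
  · rintro ⟨z, rfl⟩
    refine ⟨⟨fun i => ?_, fun i => ?_⟩, ?_⟩
    · rw [← hexact]; exact totalD_fst_mem_imAt z _
    · rw [← hexact']; exact totalD_snd_mem_imAtDual z _
    · have := totalD_fst_mem_imAt (ψ := ψ) (μ := μ) z 0
      rwa [hexact] at this
  · rintro ⟨⟨h1, h2⟩, h0⟩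
    have h3 : ∀ i, x.1 i ∈ imAt ψ μ i := by
      intro i
      rw [hexact]
      induction i using Fin.cases with
      | zero => exact h0
      | succ i => exact h1 i
    have h4 : ∀ i, x.2 i ∈ imAtDual ψ i := fun i => by rw [hexact']; exact h2 i
    have h5 : ∀ i : Fin m, ∃ z, ψ i z = x.1 i.castSucc := fun i => by
      simpa [imAt] using h3 i.castSucc
    have h6 : ∃ z, μ z = x.1 (Fin.last m) := by simpa [imAt] using h3 (Fin.last m)
    have h7 : ∀ i : Fin m, ∃ z, (ψ i).dualMap z = x.2 i.succ := fun i => h4 i.succ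
    choose z hz using h5
    obtain ⟨z', hz'⟩ := h6
    choose z'' hz'' using h7
    refine ⟨(Fin.cases 0 z, Fin.lastCases z' z''), ?_⟩
    refine Prod.ext (funext fun i => ?_) (funext fun i => ?_)
    · induction i using Fin.lastCases with
      | last => simp [totalD_fst_last, hz']
      | cast i => simp [totalD_fst_castSucc, hz]
    · induction i using Fin.cases with
      | zero => exact ((Submodule.mem_bot _).1 (h4 0)).symm
      | succ i => simp only [totalD_snd_succ, Fin.lastCases_castSucc]; exact hz'' i

/-- The inclusion of `F_0` into the direct sum of the terms of the resolution. -/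
def totalIncl (k : Type*) [Field k] (n : ℕ) {m : ℕ} (F : Fin (m + 1) → Type*)
    [∀ i, AddCommGroup (F i)] [∀ i, Module (MvPolynomial (Fin n) k) (F i)] :
    F 0 →ₗ[MvPolynomial (Fin n) k] Total k n F :=
  LinearMap.inl _ _ _ ∘ₗ LinearMap.single _ _ 0

lemma totalIncl_fst_zero (f : F 0) : (totalIncl k n F f).1 0 = f := by
  simp [totalIncl]

lemma totalIncl_fst_of_ne (f : F 0) {i : Fin (m + 1)} (hi : i ≠ 0) :
    (totalIncl k n F f).1 i = 0 := by
  simp [totalIncl, hi]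

lemma totalIncl_snd (f : F 0) : (totalIncl k n F f).2 = 0 := rfl

lemma totalD_totalIncl (f : F 0) : totalD ψ μ (totalIncl k n F f) = 0 := by
  refine Prod.ext (funext fun i => ?_) (funext fun i => ?_)
  · induction i using Fin.lastCases with
    | last => simp [totalD_fst_last, totalIncl_snd]
    | cast i => simp [totalD_fst_castSucc, totalIncl_fst_of_ne f (Fin.succ_ne_zero i)]
  · induction i using Fin.cases with
    | zero => rfl
    | succ i => simp [totalD_snd_succ, totalIncl_snd]

/-- The symmetric bilinear form on the direct sum of the terms of the resolution that is given by
the evaluation pairings between `F_i` and `F_i^∨`. -/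
def totalForm (k : Type*) [Field k] (n : ℕ) {m : ℕ} (F : Fin (m + 1) → Type*)
    [∀ i, AddCommGroup (F i)] [∀ i, Module (MvPolynomial (Fin n) k) (F i)] :
    Total k n F →ₗ[MvPolynomial (Fin n) k] Total k n F →ₗ[MvPolynomial (Fin n) k]
      MvPolynomial (Fin n) k :=
  LinearMap.mk₂ _ (fun x y => ∑ i, x.2 i (y.1 i) + ∑ i, y.2 i (x.1 i))
    (fun x x' y => by simp [Finset.sum_add_distrib]; ring)
    (fun r x y => by simp [Finset.mul_sum, mul_add])
    (fun x y y' => by simp [Finset.sum_add_distrib]; ring)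
    (fun r x y => by simp [Finset.mul_sum, mul_add])

lemma totalForm_apply (x y : Total k n F) :
    totalForm k n F x y = ∑ i, x.2 i (y.1 i) + ∑ i, y.2 i (x.1 i) := rfl

lemma totalForm_comm (x y : Total k n F) : totalForm k n F x y = totalForm k n F y x := by
  rw [totalForm_apply, totalForm_apply, add_comm]

lemma totalForm_totalIncl (x : Total k n F) (f : F 0) :
    totalForm k n F x (totalIncl k n F f) = x.2 0 f := by
  rw [totalForm_apply, totalIncl_snd, Finset.sum_eq_single 0]
  · simp [totalIncl_fst_zero]
  · intro i _ hi
    rw [totalIncl_fst_of_ne f hi, map_zero]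
  · simp

lemma totalForm_totalD_left (x y : Total k n F) : totalForm k n F (totalD ψ μ x) y =
    ∑ i : Fin m, x.2 i.castSucc (ψ i (y.1 i.succ)) +
      (∑ i : Fin m, y.2 i.castSucc (ψ i (x.1 i.succ)) +
        y.2 (Fin.last m) (μ (x.2 (Fin.last m)))) := by
  rw [totalForm_apply, Fin.sum_univ_succ, Fin.sum_univ_castSucc (fun i => y.2 i _)]
  simp only [totalD_snd_zero, totalD_snd_succ, totalD_fst_castSucc, totalD_fst_last,
    LinearMap.zero_apply, zero_add, LinearMap.dualMap_apply]

lemma totalForm_totalD_right (x y : Total k n F) : totalForm k n F x (totalD ψ μ y) =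
    ∑ i : Fin m, x.2 i.castSucc (ψ i (y.1 i.succ)) +
      (∑ i : Fin m, y.2 i.castSucc (ψ i (x.1 i.succ)) +
        x.2 (Fin.last m) (μ (y.2 (Fin.last m)))) := by
  rw [totalForm_comm, totalForm_totalD_left]
  ring

/-- Away from the source `F_m^∨` of the middle map `μ`, the differential is self-adjoint for the
form, without signs. -/
lemma totalForm_totalD_of_last_eq_zero {x : Total k n F} (hx : x.2 (Fin.last m) = 0)
    (y : Total k n F) :
    totalForm k n F (totalD ψ μ x) y = totalForm k n F x (totalD ψ μ y) := by
  rw [totalForm_totalD_left, totalForm_totalD_right, hx, map_zero, map_zero, LinearMap.zero_apply]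

/-- On the source `F_m^∨` of the middle map, the differential is self-adjoint up to the sign `ε`. -/
lemma totalForm_totalD_of_middle {ε : ℤˣ} (hμ : IsSelfDualMap ε μ) {x : Total k n F}
    (hx : x.1 = 0) (hx' : ∀ i : Fin m, x.2 i.castSucc = 0) (y : Total k n F) :
    totalForm k n F (totalD ψ μ x) y =
      ((ε : ℤ) : MvPolynomial (Fin n) k) * totalForm k n F x (totalD ψ μ y) := by
  have h := LinearMap.congr_fun (LinearMap.congr_fun hμ (y.2 (Fin.last m))) (x.2 (Fin.last m))
  rw [totalForm_totalD_left, totalForm_totalD_right]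
  simp only [hx, hx', LinearMap.zero_apply, Pi.zero_apply, map_zero, Finset.sum_const_zero,
    zero_add]
  rw [LinearMap.dualMap_apply] at h
  rw [h]
  simp [Units.smul_def]

end Total

/-! ### The bigrading of the total module -/

section TotalGrading

variable {k : Type*} [Field k] {n m : ℕ} {w : Fin n → ℤ}
  {F : Fin (m + 1) → Type*} [∀ i, AddCommGroup (F i)] [∀ i, Module (MvPolynomial (Fin n) k) (F i)]
  {r : Fin (m + 1) → ℕ}

/-- The basis of the direct sum of the `F_i` and `F_i^∨` that consists of given bases of the `F_i`
and their dual bases. -/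
def totalBasis (b : ∀ i, Module.Basis (Fin (r i)) (MvPolynomial (Fin n) k) (F i)) :
    Module.Basis ((Σ i, Fin (r i)) ⊕ (Σ i, Fin (r i))) (MvPolynomial (Fin n) k) (Total k n F) :=
  (Pi.basis b).prod (Pi.basis fun i => (b i).dualBasis)

/-- The homological and internal degrees of the basis elements: `F_i` sits in homological
degree `i`, and `F_i^∨(-s)` in homological degree `n - i`. -/
def totalDeg (w : Fin n → ℤ) (s : ℤ) (a : ∀ i : Fin (m + 1), Fin (r i) → ℤ) :
    (Σ i, Fin (r i)) ⊕ (Σ i, Fin (r i)) → ℤ × ℤ :=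
  Sum.elim (fun p => ((p.1 : ℕ), a p.1 p.2)) fun p => (n - (p.1 : ℕ), ∑ l, w l - a p.1 p.2 + s)

variable {b : ∀ i, Module.Basis (Fin (r i)) (MvPolynomial (Fin n) k) (F i)}
  {a : ∀ i, Fin (r i) → ℤ}

lemma totalBasis_repr_inl (x : Total k n F) (i : Fin (m + 1)) (j : Fin (r i)) :
    (totalBasis b).repr x (Sum.inl ⟨i, j⟩) = (b i).repr (x.1 i) j := by
  simp [totalBasis]

lemma totalBasis_repr_inr (x : Total k n F) (i : Fin (m + 1)) (j : Fin (r i)) :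
    (totalBasis b).repr x (Sum.inr ⟨i, j⟩) = x.2 i (b i j) := by
  simp [totalBasis]

/-- On the last term `F_0^∨` of the resolution, the form detects divisibility. -/
lemma mem_spanSMul_of_totalForm
    (b : ∀ i, Module.Basis (Fin (r i)) (MvPolynomial (Fin n) k) (F i)) {x : Total k n F}
    (hx : x.1 = 0) (hx' : ∀ i ≠ 0, x.2 i = 0) (y : ℕ → MvPolynomial (Fin n) k) (S : Set ℕ)
    (h : ∀ f, totalForm k n F x (totalIncl k n F f) ∈ Ideal.span (y '' S)) :
    x ∈ spanSMul (Total k n F) y S := by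
  rw [mem_spanSMul_iff_repr (totalBasis b)]
  rintro (⟨i, j⟩ | ⟨i, j⟩)
  · rw [totalBasis_repr_inl, hx, Pi.zero_apply, map_zero]
    exact Ideal.zero_mem _
  · rw [totalBasis_repr_inr]
    by_cases hi : i = 0
    · subst hi
      rw [← totalForm_totalIncl]
      exact h _
    · rw [hx' i hi]
      exact Ideal.zero_mem _

variable [∀ i, Module k (F i)] [∀ i, IsScalarTower k (MvPolynomial (Fin n) k) (F i)]
  {𝓕 : ∀ i, ℤ → Submodule k (F i)} {s : ℤ}

lemma mem_totalGrading_iff (h𝓕 : ∀ i e, 𝓕 i e = basisGrading w (b i) (a i) e) {p c : ℤ}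
    {x : Total k n F} :
    x ∈ basisGrading (biweight w) (totalBasis b) (totalDeg w s a) (p, c) ↔
      (∀ i, x.1 i ∈ 𝓕 i c ∧ (((i : ℕ) : ℤ) ≠ p → x.1 i = 0)) ∧
        ∀ i, x.2 i ∈ twist (rdualGrading w (𝓕 i)) (-s) c ∧ ((n : ℤ) - (i : ℕ) ≠ p → x.2 i = 0) := by
  have h1 : ∀ i, x.1 i = 0 ↔ ∀ j, (b i).repr (x.1 i) j = 0 := fun i => by
    rw [← (b i).repr.map_eq_zero_iff, Finsupp.ext_iff]; rfl
  have h2 : ∀ i, x.2 i = 0 ↔ ∀ j, x.2 i (b i j) = 0 := fun i =>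
    ⟨fun h j => by rw [h]; rfl, fun h => (b i).ext h⟩
  rw [mem_basisGrading, Sum.forall]
  refine and_congr ?_ ?_ <;> rw [Sigma.forall] <;> refine forall_congr' fun i => ?_
  · simp only [totalBasis_repr_inl, mem_biweight_iff, totalDeg, Sum.elim_inl, Prod.mk_sub_mk]
    rw [forall_and, h𝓕, h1, ← mem_basisGrading]
    refine and_congr Iff.rfl ⟨fun h hi j => h j (by omega), fun h j hj => h (by omega) j⟩
  · simp only [totalBasis_repr_inr, mem_biweight_iff, totalDeg, Sum.elim_inr, Prod.mk_sub_mk]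
    rw [forall_and, twist, rdualGrading_eq_basisGrading (h𝓕 i), h2, mem_basisGrading]
    simp only [Module.Basis.dualBasis_repr]
    refine and_congr (forall_congr' fun j => ?_)
      ⟨fun h hi j => h j (by omega), fun h j hj => h (by omega) j⟩
    rw [show c - (∑ l, w l - a i j + s) = c + -s - (∑ l, w l - a i j) by ring]

lemma totalIncl_mem (h𝓕 : ∀ i e, 𝓕 i e = basisGrading w (b i) (a i) e) {c : ℤ} {f : F 0}
    (hf : f ∈ 𝓕 0 c) : totalIncl k n F f ∈
      basisGrading (biweight w) (totalBasis b) (totalDeg w s a) (0, c) := by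
  rw [mem_totalGrading_iff h𝓕]
  refine ⟨fun i => ?_, fun i => ⟨Submodule.zero_mem _, fun _ => rfl⟩⟩
  by_cases hi : i = 0
  · subst hi
    rw [totalIncl_fst_zero]
    exact ⟨hf, fun h => absurd rfl h⟩
  · rw [totalIncl_fst_of_ne f hi]
    exact ⟨Submodule.zero_mem _, fun _ => rfl⟩

lemma totalD_mem (hn : n = 2 * m + 1) (h𝓕 : ∀ i e, 𝓕 i e = basisGrading w (b i) (a i) e)
    {ψ : ∀ i : Fin m, F i.succ →ₗ[MvPolynomial (Fin n) k] F i.castSucc}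
    {μ : Module.Dual (MvPolynomial (Fin n) k) (F (Fin.last m)) →ₗ[MvPolynomial (Fin n) k]
      F (Fin.last m)}
    (hψ : ∀ i : Fin m, IsGradedHom (𝓕 i.succ) (𝓕 i.castSucc) (ψ i))
    (hμ : IsGradedHom (twist (rdualGrading w (𝓕 (Fin.last m))) (-s)) (𝓕 (Fin.last m)) μ)
    {p c : ℤ} {x : Total k n F}
    (hx : x ∈ basisGrading (biweight w) (totalBasis b) (totalDeg w s a) (p, c)) :
    totalD ψ μ x ∈ basisGrading (biweight w) (totalBasis b) (totalDeg w s a) (p - 1, c) := by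
  rw [mem_totalGrading_iff h𝓕] at hx ⊢
  obtain ⟨h1, h2⟩ := hx
  refine ⟨fun i => ?_, fun i => ?_⟩
  · induction i using Fin.lastCases with
    | last =>
      rw [totalD_fst_last]
      refine ⟨hμ _ _ (h2 _).1, fun h => ?_⟩
      rw [(h2 _).2 (by simp only [Fin.val_last] at h ⊢; omega), map_zero]
    | cast i =>
      rw [totalD_fst_castSucc]
      refine ⟨hψ i _ _ (h1 _).1, fun h => ?_⟩
      rw [(h1 _).2 (by simp only [Fin.val_castSucc, Fin.val_succ] at h ⊢; omega), map_zero]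
  · induction i using Fin.cases with
    | zero => exact ⟨Submodule.zero_mem _, fun _ => rfl⟩
    | succ i =>
      rw [totalD_snd_succ]
      refine ⟨fun e z hz => (h2 i.castSucc).1 e _ (hψ i e z hz), fun h => ?_⟩
      rw [(h2 _).2 (by simp only [Fin.val_castSucc, Fin.val_succ] at h ⊢; omega), map_zero]

lemma totalForm_mem (h𝓕 : ∀ i e, 𝓕 i e = basisGrading w (b i) (a i) e) {p q c e : ℤ}
    {x y : Total k n F}
    (hx : x ∈ basisGrading (biweight w) (totalBasis b) (totalDeg w s a) (p, c))
    (hy : y ∈ basisGrading (biweight w) (totalBasis b) (totalDeg w s a) (q, e)) :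
    totalForm k n F x y ∈ weightedHomogeneousSubmodule k w (c + e - s - ∑ l, w l) := by
  rw [mem_totalGrading_iff h𝓕] at hx hy
  rw [totalForm_apply]
  refine Submodule.add_mem _ (Submodule.sum_mem _ fun i _ => ?_)
    (Submodule.sum_mem _ fun i _ => ?_)
  · convert! (hx.2 i).1 _ _ (hy.1 i).1 using 1
    rw [twist]; congr 1; ring
  · convert! (hy.2 i).1 _ _ (hx.1 i).1 using 1
    rw [twist]; congr 1; ring

end TotalGrading

/-! ### The residue pairing -/

section Pairing

variable {k : Type*} [Field k] {n m : ℕ} {w : Fin n → ℤ}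
  {M : Type*} [AddCommGroup M] [Module k M] [Module (MvPolynomial (Fin n) k) M]
  {𝓜 : ℤ → Submodule k M}
  {F : Fin (m + 1) → Type*} [∀ i, AddCommGroup (F i)] [∀ i, Module k (F i)]
  [∀ i, Module (MvPolynomial (Fin n) k) (F i)]
  [∀ i, IsScalarTower k (MvPolynomial (Fin n) k) (F i)]
  {𝓕 : ∀ i, ℤ → Submodule k (F i)} {s : ℤ}
  {π : F 0 →ₗ[MvPolynomial (Fin n) k] M}
  {ψ : ∀ i : Fin m, F i.succ →ₗ[MvPolynomial (Fin n) k] F i.castSucc}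
  {μ : Module.Dual (MvPolynomial (Fin n) k) (F (Fin.last m)) →ₗ[MvPolynomial (Fin n) k]
    F (Fin.last m)}
  {r : Fin (m + 1) → ℕ} {b : ∀ i, Module.Basis (Fin (r i)) (MvPolynomial (Fin n) k) (F i)}
  {a : ∀ i, Fin (r i) → ℤ}

/-- The total sign from moving all homotopies across the form: `(-1)^l` from passing `d` through `l`
homotopies, and `ε` from the middle map. -/
lemma prod_sign (m : ℕ) (ε : ℤˣ) :
    ∏ l ∈ Finset.range (2 * m + 1), (if l = m then ε else 1) * (-1) ^ l = ε * (-1) ^ m := by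
  rw [Finset.prod_mul_distrib, Finset.prod_ite_eq', if_pos (by simp; omega)]
  congr 1
  induction m with
  | zero => simp
  | succ m ih =>
    rw [show 2 * (m + 1) + 1 = 2 * m + 1 + 1 + 1 by ring, Finset.prod_range_succ,
      Finset.prod_range_succ, ih]
    simp [pow_succ, pow_mul]

lemma exists_homotopy_powVar (hn : n = 2 * m + 1)
    (hres : IsSelfdualMinimalResolution w s 𝓜 𝓕 π ψ μ)
    (h𝓕 : ∀ i e, 𝓕 i e = basisGrading w (b i) (a i) e) {N : ℕ}
    (hN : ∀ (l : Fin n) (x : M), (X l : MvPolynomial (Fin n) k) ^ N • x = 0) (l : Fin n) :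
    ∃ h : Module.End (MvPolynomial (Fin n) k) (Total k n F),
      (∀ i, h (totalBasis b i) ∈ basisGrading (biweight w) (totalBasis b) (totalDeg w s a)
        (totalDeg w s a i + (1, N • w l))) ∧
      totalD ψ μ * h + h * totalD ψ μ = (X l : MvPolynomial (Fin n) k) ^ N • 1 := by
  have hrange := mem_range_totalD_iff hres.exact hres.exact_dual
  refine exists_homotopy ?_ (totalD ψ μ) (fun i => ?_) (fun x => ?_) _ _
    ((isWeightedHomogeneous_X k w l).pow N) (fun p c x hp hx hdx => ?_) (fun c x hx => ?_)
  · rintro (⟨i, j⟩ | ⟨i, j⟩)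
    · simp [totalDeg]
    · have := i.2
      simp only [totalDeg, Sum.elim_inr]
      omega
  · have := totalD_mem hn h𝓕 hres.graded_map hres.graded_mid (p := (totalDeg w s a i).1)
      (c := (totalDeg w s a i).2) (basis_mem_basisGrading i)
    convert! this using 2
    ext <;> simp [sub_eq_add_neg]
  · exact ((hrange _).1 ⟨x, rfl⟩).1
  · rw [mem_totalGrading_iff h𝓕] at hx
    rw [hrange, (hx.1 0).2 (by simpa using hp.ne), map_zero]
    exact ⟨hdx, rfl⟩
  · rw [mem_totalGrading_iff h𝓕] at hx
    refine (hrange _).2 ⟨?_, ?_⟩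
    · have hx0 : totalD ψ μ x = 0 := by
        rw [totalD_eq_zero_iff (π := π)]
        refine ⟨fun i => ?_, fun i => ?_⟩
        · rw [(hx.1 i.succ).2 (by simp only [Fin.val_succ]; omega)]
          exact Submodule.zero_mem _
        · rw [(hx.2 i).2 (by have := i.2; omega)]
          exact Submodule.zero_mem _
      rw [map_smul, hx0, smul_zero]
    · rw [Prod.smul_fst, Pi.smul_apply, map_smul, hN]

/-- The pairing on `F_0` that induces the pairing of `M` with itself: if the `h_l` are
null-homotopies of `X_l ^ N`, then `f` and `g` are paired to the coefficient of the socle monomial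
of `R / (X_0^N, …, X_{n-1}^N)` in `(h_0 ⋯ h_{n-1} f)(g)`, where `h_0 ⋯ h_{n-1} f ∈ F_0^∨`. -/
theorem exists_pairing (hn : n = 2 * m + 1)
    (hres : IsSelfdualMinimalResolution w s 𝓜 𝓕 π ψ μ) {ε : ℤˣ} (hμ : IsSelfDualMap ε μ)
    (h𝓕 : ∀ i e, 𝓕 i e = basisGrading w (b i) (a i) e) {N : ℕ} (hNpos : 0 < N)
    (hN : ∀ (l : Fin n) (x : M), (X l : MvPolynomial (Fin n) k) ^ N • x = 0) :
    ∃ β : F 0 →ₗ[k] F 0 →ₗ[k] k,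
      (∀ (r : MvPolynomial (Fin n) k) f g, β (r • f) g = β f (r • g)) ∧
      (∀ f g, β g f = (ε * (-1) ^ m) • β f g) ∧
      (∀ f g, π g = 0 → β f g = 0) ∧
      (∀ f, (∀ g, β f g = 0) → π f = 0) ∧
      ∀ i j, ∀ f ∈ 𝓕 0 i, ∀ g ∈ 𝓕 0 j, i + j ≠ s → β f g = 0 := by
  have hrange := mem_range_totalD_iff hres.exact hres.exact_dual
  let t : ℕ → ℤ := fun l => if hl : l < n then N • w ⟨l, hl⟩ else 0
  have hex : ∀ l, ∃ h : Module.End (MvPolynomial (Fin n) k) (Total k n F),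
      (∀ i, h (totalBasis b i) ∈ basisGrading (biweight w) (totalBasis b) (totalDeg w s a)
        (totalDeg w s a i + (1, t l))) ∧
      totalD ψ μ * h + h * totalD ψ μ = powVar k n N l • 1 := by
    intro l
    by_cases hl : l < n
    · simpa only [t, powVar, hl, dif_pos] using exists_homotopy_powVar hn hres h𝓕 hN ⟨l, hl⟩
    · exact ⟨0, fun i => Submodule.zero_mem _, by simp [powVar, hl]⟩
  choose h hhom hd using hex
  -- `i` homotopies map `F_0` into homological degree `i`
  have hsupp : ∀ (i j : ℕ) (f : F 0),
      (∀ i', i' ≠ i → ∀ hi' : i' < m + 1,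
        (iterComp h j i (totalIncl k n F f)).1 ⟨i', hi'⟩ = 0) ∧
      ∀ i', i' + i ≠ n → ∀ hi' : i' < m + 1,
        (iterComp h j i (totalIncl k n F f)).2 ⟨i', hi'⟩ = 0 := by
    intro i j f
    have hf : f ∈ ⨆ e, 𝓕 0 e := by
      rw [(hres.gradedFree 0).isGradedModule.isInternal.submodule_iSup_eq_top]; trivial
    induction hf using Submodule.iSup_induction' with
    | mem e f hf =>
      have := iterComp_mem_basisGrading hhom i j (totalIncl_mem (s := s) h𝓕 hf)
      rw [mem_totalGrading_iff h𝓕] at this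
      refine ⟨fun i' hne hi' => (this.1 ⟨i', hi'⟩).2 ?_,
        fun i' hne hi' => (this.2 ⟨i', hi'⟩).2 ?_⟩ <;> simp only <;> omega
    | zero => simp
    | add f g _ _ h1 h2 =>
      refine ⟨fun i' hne hi' => ?_, fun i' hne hi' => ?_⟩
      · simp [h1.1 i' hne hi', h2.1 i' hne hi']
      · simp [h1.2 i' hne hi', h2.2 i' hne hi']
  -- `n - j` is the homological degree `m + 1` of `F_m^∨` exactly for `j = m`
  have hadj : ∀ (j : ℕ) (f : F 0) (y : Total k n F), j ≤ n →
      totalForm k n F (totalD ψ μ (iterComp h j (n - j) (totalIncl k n F f))) y =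
        (((if j = m then ε else 1 : ℤˣ) : ℤ) : MvPolynomial (Fin n) k) *
          totalForm k n F (iterComp h j (n - j) (totalIncl k n F f)) (totalD ψ μ y) := by
    intro j f y hj
    split_ifs with hjm
    · refine totalForm_totalD_of_middle hμ (funext fun i => ?_) (fun i => ?_) y
      · exact (hsupp (n - j) j f).1 i (by have := i.2; omega) i.2
      · exact (hsupp (n - j) j f).2 i (by have := i.2; omega) (by omega)
    · rw [totalForm_totalD_of_last_eq_zero]
      · simp
      · exact (hsupp (n - j) j f).2 m (by omega) (by omega)
  have hreg : ∀ l < n, ∀ S : Set ℕ, l ∉ S → ∀ r, powVar k n N l * r ∈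
      Ideal.span (powVar k n N '' S) → r ∈ Ideal.span (powVar k n N '' S) :=
    fun l hl S hlS r hr => powVar_regular hl hlS hr
  let Φ : F 0 →ₗ[MvPolynomial (Fin n) k] F 0 →ₗ[MvPolynomial (Fin n) k]
      MvPolynomial (Fin n) k :=
    (totalForm k n F).compl₁₂ (iterComp h 0 n ∘ₗ totalIncl k n F) (totalIncl k n F)
  have hΦ : ∀ f g, Φ f g =
      totalForm k n F (iterComp h 0 n (totalIncl k n F f)) (totalIncl k n F g) := fun _ _ => rfl
  let β : F 0 →ₗ[k] F 0 →ₗ[k] k := LinearMap.mk₂ k (fun f g => coeff (socleExp n N) (Φ f g))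
    (fun f f' g => by simp) (fun c f g => by
      rw [← algebraMap_smul (MvPolynomial (Fin n) k) c f, map_smul, LinearMap.smul_apply,
        algebraMap_smul, coeff_smul])
    (fun f g g' => by simp) (fun c f g => by
      rw [← algebraMap_smul (MvPolynomial (Fin n) k) c g, map_smul,
        algebraMap_smul, coeff_smul])
  have hβ : ∀ f g, β f g = coeff (socleExp n N) (Φ f g) := fun _ _ => rfl
  refine ⟨β, fun r f g => ?_, fun f g => ?_, fun f g hg => ?_, fun f hf => ?_,
    fun i j f hf g hg hij => ?_⟩
  · rw [hβ, hβ, map_smul, map_smul, LinearMap.smul_apply]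
  · have h1 := bilin_iterComp_sub_mem hd hreg (totalForm k n F)
      (fun j => (((if j = m then ε else 1 : ℤˣ) : ℤ) : MvPolynomial (Fin n) k))
      (totalD_totalIncl f) (totalD_totalIncl g) (fun j hj => hadj j f _ hj.le) n le_rfl
    have h2 : (∏ l ∈ Finset.range n,
        (((if l = m then ε else 1 : ℤˣ) : ℤ) : MvPolynomial (Fin n) k) * (-1) ^ l) =
          (((ε * (-1) ^ m : ℤˣ) : ℤ) : MvPolynomial (Fin n) k) := by
      rw [← prod_sign, hn]
      push_cast
      rfl
    rw [h2, Nat.sub_self, totalForm_comm] at h1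
    have h3 := coeff_socleExp_of_mem hNpos h1
    rw [coeff_sub, sub_eq_zero] at h3
    refine h3.trans ?_
    rw [← zsmul_eq_mul, coeff_smul, Units.smul_def]
    rfl
  · obtain ⟨z, hz⟩ := (hrange (totalIncl k n F g)).2
      ⟨totalD_totalIncl g, by rw [totalIncl_fst_zero, hg]⟩
    have h1 := hadj 0 f z (Nat.zero_le n)
    rw [Nat.sub_zero, hz] at h1
    have h2 := mem_spanSMul_self.1 (map_mem_spanSMul ((totalForm k n F).flip z)
      (d_iterComp_mem hd (totalD_totalIncl f) n 0))
    rw [LinearMap.flip_apply, h1] at h2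
    have h3 := Ideal.mul_mem_left _
      (((if 0 = m then ε else 1 : ℤˣ) : ℤ) : MvPolynomial (Fin n) k) h2
    rw [← mul_assoc, ← Int.cast_mul, ← Units.val_mul, Int.units_mul_self, Units.val_one,
      Int.cast_one, one_mul] at h3
    exact coeff_socleExp_of_mem hNpos h3
  · have h1 : iterComp h 0 n (totalIncl k n F f) ∈
        spanSMul (Total k n F) (powVar k n N) (Set.Iio n) := by
      refine mem_spanSMul_of_totalForm b (funext fun i => ?_) (fun i hi => ?_) _ _ fun g => ?_
      · exact (hsupp n 0 f).1 i (by have := i.2; omega) i.2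
      · have := Fin.val_ne_of_ne hi
        exact (hsupp n 0 f).2 i (by simp only [Fin.val_zero] at this; omega) i.2
      · refine mem_span_powVar_of_coeff fun r => ?_
        have := hf (r • g)
        rwa [hβ, map_smul, smul_eq_mul] at this
    have h2 := mem_range_of_iterComp_mem hd (fun x => ((hrange _).1 ⟨x, rfl⟩).1)
      (fun l hl S hlS x hx => powVar_smul_regular (totalBasis b) hl hlS hx)
      (totalD_totalIncl f) n 0 (by omega) (Submodule.mem_sup_left (spanSMul_mono (by
        intro l; simp) h1))
    have h3 := ((hrange _).1 h2).2
    rwa [totalIncl_fst_zero] at h3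
  · have h1 := totalForm_mem h𝓕
      (iterComp_mem_basisGrading hhom n 0 (totalIncl_mem (s := s) h𝓕 hf))
      (totalIncl_mem (s := s) h𝓕 hg)
    rw [mem_weightedHomogeneousSubmodule] at h1
    refine h1.coeff_eq_zero _ ?_
    have h2 : ∑ l ∈ Finset.Ico 0 (0 + n), t l = N • ∑ l, w l := by
      rw [zero_add, ← Finset.range_eq_Ico, Finset.sum_range, Finset.smul_sum]
      exact Finset.sum_congr rfl fun l _ => by simp [t]
    have h3 : Finsupp.weight w (socleExp n N) = N • ∑ l, w l - ∑ l, w l := by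
      rw [Finsupp.weight_apply, Finsupp.sum_fintype _ _ (by simp), Finset.smul_sum,
        ← Finset.sum_sub_distrib]
      refine Finset.sum_congr rfl fun l _ => ?_
      simp only [socleExp, Finsupp.equivFunOnFinite_symm_apply_apply, nsmul_eq_mul]
      rw [Nat.cast_sub hNpos]
      ring
    rw [h2, h3]
    omega

end Pairing

section VDual

variable {k : Type*} [Field k] {n : ℕ} {M : Type*} [AddCommGroup M] [Module k M]
  [Module (MvPolynomial (Fin n) k) M] [IsScalarTower k (MvPolynomial (Fin n) k) M]
  {𝓜 : ℤ → Submodule k M}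

lemma iSupIndep_vdualGrading (hM : ⨆ i, 𝓜 i = ⊤) : iSupIndep (vdualGrading 𝓜) := by
  intro j
  rw [Submodule.disjoint_def]
  intro f hf hf'
  have h1 : ∀ x ∈ 𝓜 (-j), f x = 0 := by
    intro x hx
    have hle : (⨆ (j') (_ : j' ≠ j), vdualGrading 𝓜 j') ≤
        LinearMap.ker (Module.Dual.eval k M x : Module.Dual k (Module.Dual k M)) :=
      iSup₂_le fun j' hj' g hg => hg (-j) x hx (by omega)
    exact hle hf'
  have h2 : (⊤ : Submodule k M) ≤ LinearMap.ker (show Module.Dual k M from f) := by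
    rw [← hM]
    refine iSup_le fun i x hx => ?_
    by_cases hi : i = -j
    · exact h1 x (hi ▸ hx)
    · exact hf i x hx hi
  exact LinearMap.ext fun x => h2 (Submodule.mem_top (x := x))

end VDual

end SelfdualRes
end

theorem mainTheorem2 {k : Type*} [Field k] {n m : ℕ} (hn : n = 2 * m + 1)
    (w : Fin n → ℤ) (hw : ∀ l, 0 < w l)
    {M : Type*} [AddCommGroup M] [Module k M] [Module (MvPolynomial (Fin n) k) M]
    [IsScalarTower k (MvPolynomial (Fin n) k) M]
    (𝓜 : ℤ → Submodule k M) (hM : SelfdualRes.IsGradedModule w 𝓜)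
    (hfin : IsFiniteLength (MvPolynomial (Fin n) k) M)
    {F : Fin (m + 1) → Type*} [∀ i, AddCommGroup (F i)] [∀ i, Module k (F i)]
    [∀ i, Module (MvPolynomial (Fin n) k) (F i)]
    [∀ i, IsScalarTower k (MvPolynomial (Fin n) k) (F i)]
    (𝓕 : ∀ i, ℤ → Submodule k (F i)) (s : ℤ)
    (π : F 0 →ₗ[MvPolynomial (Fin n) k] M)
    (ψ : ∀ i : Fin m, F i.succ →ₗ[MvPolynomial (Fin n) k] F i.castSucc)
    (μ : Module.Dual (MvPolynomial (Fin n) k) (F (Fin.last m)) →ₗ[MvPolynomial (Fin n) k]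
      F (Fin.last m))
    (hres : SelfdualRes.IsSelfdualMinimalResolution w s 𝓜 𝓕 π ψ μ)
    (ε : ℤˣ) (hμ : SelfdualRes.IsSelfDualMap ε μ) :
    (∃ τ : M ≃ₗ[MvPolynomial (Fin n) k] SelfdualRes.VDual k M,
      SelfdualRes.IsGradedIso 𝓜 (SelfdualRes.twist (SelfdualRes.vdualGrading 𝓜) (-s)) τ ∧
      SelfdualRes.IsSelfTranspose (ε * (-1) ^ m) τ.toLinearMap) ∧
    SelfdualRes.IsGorenstein n 𝓜 := by
  open SelfdualRes in
  suffices h : ∃ τ : M ≃ₗ[MvPolynomial (Fin n) k] VDual k M,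
      IsGradedIso 𝓜 (twist (vdualGrading 𝓜) (-s)) τ ∧
      IsSelfTranspose (ε * (-1) ^ m) τ.toLinearMap from ⟨h, s, _, h⟩
  have : IsArtinian (MvPolynomial (Fin n) k) M :=
    (isFiniteLength_iff_isNoetherian_isArtinian.1 hfin).2
  choose r b a h𝓕 using fun i => (hres.gradedFree i).exists_eq_basisGrading
  have hb : ∀ j, π (b 0 j) ∈ 𝓜 (a 0 j) := fun j =>
    hres.graded_aug _ _ (by rw [h𝓕]; exact basis_mem_basisGrading j)
  obtain ⟨N, hNpos, hN⟩ :=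
    exists_uniform_pow_smul_eq_zero hw hM π hres.surjective_aug (b 0) (a 0) hb
  have hkfin : Module.Finite k M :=
    finite_of_pow_smul_eq_zero π hres.surjective_aug (b 0) hN
  obtain ⟨β, hβr, hβsymm, hβker, hβnd, hβdeg⟩ := exists_pairing hn hres hμ h𝓕 hNpos hN
  have hβker' : ∀ f g, π f = 0 → β f g = 0 := fun f g hf => by
    rw [hβsymm, hβker g f hf, smul_zero]
  have hsub : ∀ {f f' : F 0}, π f = π f' → ∀ g, β f g = β f' g := fun {f f'} h g => by
    rw [← sub_eq_zero, ← LinearMap.sub_apply, ← map_sub]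
    exact hβker' _ _ (by rw [map_sub, h, sub_self])
  have hsub' : ∀ {g g' : F 0}, π g = π g' → ∀ f, β f g = β f g' := fun {g g'} h f => by
    rw [← sub_eq_zero, ← map_sub]
    exact hβker _ _ (by rw [map_sub, h, sub_self])
  choose σ hσ using hres.surjective_aug
  have hπk : ∀ (c : k) (f : F 0), π (c • f) = c • π f := (π.restrictScalars k).map_smul
  let T : M →ₗ[k] M →ₗ[k] k := LinearMap.mk₂ k (fun y z => β (σ y) (σ z))
    (fun y y' z => by
      rw [← LinearMap.add_apply, ← map_add]; exact hsub (by simp [hσ]) _)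
    (fun c y z => by
      rw [← LinearMap.smul_apply, ← map_smul]; exact hsub (by simp [hσ, hπk]) _)
    (fun y z z' => by rw [← map_add]; exact hsub' (by simp [hσ]) _)
    (fun c y z => by rw [← map_smul]; exact hsub' (by simp [hσ, hπk]) _)
  have hT : ∀ f g, T (π f) (π g) = β f g := fun f g =>
    (hsub (hσ _) _).trans (hsub' (hσ _) _)
  have hTinj : Function.Injective T := by
    rw [injective_iff_map_eq_zero]
    intro y hy
    obtain ⟨f, rfl⟩ := hres.surjective_aug y
    exact hβnd f fun g => by rw [← hT, hy, LinearMap.zero_apply]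
  have hTbij : Function.Bijective T :=
    ⟨hTinj, (LinearMap.injective_iff_surjective_of_finrank_eq_finrank
      (Subspace.dual_finrank_eq (K := k) (V := M)).symm).1 hTinj⟩
  let T' : M →ₗ[MvPolynomial (Fin n) k] VDual k M :=
    { toFun := T
      map_add' := map_add T
      map_smul' := fun q y => LinearMap.ext fun z => by
        obtain ⟨f, rfl⟩ := hres.surjective_aug y
        obtain ⟨g, rfl⟩ := hres.surjective_aug z
        change T (q • π f) (π g) = T (π f) (q • π g)
        rw [← map_smul, ← map_smul, hT, hT, hβr] }
  let τ : M ≃ₗ[MvPolynomial (Fin n) k] VDual k M := LinearEquiv.ofBijective T' hTbij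
  have hFtop := (hres.gradedFree 0).isGradedModule.isInternal.submodule_iSup_eq_top
  have hMtop := hM.isInternal.submodule_iSup_eq_top
  have hlift : ∀ e, ∀ y ∈ 𝓜 e, ∃ f ∈ 𝓕 0 e, π f = y := by
    intro e y hy
    obtain ⟨f, rfl⟩ := hres.surjective_aug y
    exact exists_homogeneous_lift hFtop hM.isInternal.submodule_iSupIndep
      (π.restrictScalars k) 0 (fun e x hx => by simpa using hres.graded_aug e x hx) e f
      (by simpa using hy)
  have hτ : IsGradedHom 𝓜 (twist (vdualGrading 𝓜) (-s)) τ.toLinearMap := by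
    intro j y hy i z hz hij
    obtain ⟨f, hf, rfl⟩ := hlift j y hy
    obtain ⟨g, hg, rfl⟩ := hlift i z hz
    exact (hT f g).trans (hβdeg j i f hf g hg (by omega))
  refine ⟨τ, ⟨hτ, fun j f hf => ?_⟩, LinearMap.ext fun y => LinearMap.ext fun z => ?_⟩
  · have hind : iSupIndep (twist (vdualGrading 𝓜) (-s)) :=
      (iSupIndep_vdualGrading hMtop).comp (add_left_injective (-s))
    obtain ⟨y, hy, hyf⟩ := exists_homogeneous_lift hMtop hind
      (τ.toLinearMap.restrictScalars k) 0
      (fun e x hx => by rw [add_zero]; exact hτ e x hx) j (τ.symm f)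
      (by
        rw [add_zero]
        change τ (τ.symm f) ∈ _
        rwa [τ.apply_symm_apply])
    have hyf : y = τ.symm f := τ.injective hyf
    change τ.symm f ∈ 𝓜 j
    rwa [← hyf]
  · obtain ⟨f, rfl⟩ := hres.surjective_aug y
    obtain ⟨g, rfl⟩ := hres.surjective_aug z
    change T (π g) (π f) = (ε * (-1) ^ m) • T (π f) (π g)
    rw [hT, hT, hβsymm]
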